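/- Let $d,p\in\mathbb{N}_0$ and let $J\subset\mathbb{R}^{d+1}$, with points written $(x_1,\dots,x_d,t)$, be a bounded open set that is star-shaped with respect to some ball $B\subset J$, i.e. with respect to every point of $B$. Let $\mathcal P_p(J)$ be the space of polynomials on $J$ of total degree at most $p$, let $\|\cdot\|_J$ be the norm of $L^2(J)$ and $\|v\|_{H^{k}(J)}^2=\sum_{|\alpha|\le k}\|D^\alpha v\|_J^2$. Let $\rho_{\max}$ be the supremum of the radii of the balls with respect to which $J$ is star-shaped, and call $\operatorname{diam}(J)/\rho_{\max}$ the chunkiness of $J$. For a ball $B$ with respect to which $J$ is star-shaped, and a weight $\varphi\in C_0^\infty(\mathbb{R}^{d+1})$ with $\operatorname{supp}\varphi=\overline B$ and $\int_B\varphi=1$, the averaged Taylor polynomial of order $k$ of $v$ is $$\Pi^{k}v(x)=\sum_{|\alpha|\le k}\frac1{\alpha!}\int_B D^\alpha v(y)\,(x-y)^\alpha\varphi(y)\,dy .$$ 1. There is a constant $C$ depending only on $d$, $p$ and (an upper bound of) the chunkiness of $J$, such that for a suitable ball $B$ and a suitable weight $\varphi$ as above (depending only on $J$), the operator $\Pi^p$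 is a linear projector of $H^{p+1}(J)$ onto $\mathcal P_p(J)$ with $$\|D^\beta(v-\Pi^{p}v)\|_{J}\le C\,(\operatorname{diam} J)^{p+1-|\beta|}\,\|v\|_{H^{p+1}(J)},\qquad |\beta|\le p,\ v\in H^{p+1}(J),$$ and for every constant $a>0$, if $v\in H^{p+1}(J)$ satisfies the wave equation $\ddot v-\nabla\cdot(a\nabla v)=0$ in $J$ (in the sense of distributions), then so does $\Pi^pv$. 2. For every ball $B$ and every weight $\varphi$ as above, $\Pi^p$ is a linear projector of $H^{p+1}(J)$ onto $\mathcal P_p(J)$, satisfies the bounds of part 1 with some constant $C$ (which may depend on $d,p,J,B,\varphi$ but not on $v,\beta$), and maps solutions $v \in H^{p+1}(J)$ of the wave equation with constant $a>0$ to solutions. Moreover, for all $v\in H^{p+1}(J)$ and $|\alpha|\le p$, one has $D^\alpha v\in H^{p+1-|\alpha|}(J)$ and $$D^\alpha\Pi^{p}v=\Pi^{p-|\alpha|}D^\alpha v .$$ -/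

import Mathlib

open MeasureTheory
open scoped ContDiff

noncomputable section

namespace Trefftz

/-- Euclidean space `ℝⁿ`. -/
abbrev Eu (n : ℕ) : Type := EuclideanSpace ℝ (Fin n)

/-! ### Multi-indices and classical partial derivatives -/

/-- The finite set of multi-indices `α ∈ ℕⁿ` with `|α| ≤ k`. -/
def multiIdx (n k : ℕ) : Finset (Fin n → ℕ) :=
  {α ∈ Fintype.piFinset fun _ : Fin n => Finset.range (k + 1) | ∑ i, α i ≤ k}

theorem mem_multiIdx {n k : ℕ} {α : Fin n → ℕ} : α ∈ multiIdx n k ↔ ∑ i, α i ≤ k := by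
  simp only [multiIdx, Finset.mem_filter, Fintype.mem_piFinset, Finset.mem_range,
    and_iff_right_iff_imp]
  intro h i
  have := Finset.single_le_sum (f := α) (fun j _ => Nat.zero_le _) (Finset.mem_univ i)
  omega

/-- The classical partial derivative `∂ᵢ f`. -/
def partialD {n : ℕ} (i : Fin n) (f : Eu n → ℝ) : Eu n → ℝ :=
  fun x => fderiv ℝ f x (EuclideanSpace.single i 1)

/-- The classical derivative `D^α f = ∂₀^{α₀} ⋯ ∂ₙ₋₁^{αₙ₋₁} f`. -/
def mderiv {n : ℕ} (α : Fin n → ℕ) (f : Eu n → ℝ) : Eu n → ℝ :=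
  (List.finRange n).foldr (fun i g => (partialD i)^[α i] g) f

/-- A test function on `J`, i.e. an element of `C_c^∞(J)`. -/
structure IsTest {n : ℕ} (J : Set (Eu n)) (ψ : Eu n → ℝ) : Prop where
  smooth : ContDiff ℝ ∞ ψ
  compact : HasCompactSupport ψ
  supp : tsupport ψ ⊆ J

theorem partialD_good {n : ℕ} (i : Fin n) {f : Eu n → ℝ}
    (hf : ContDiff ℝ ∞ f ∧ HasCompactSupport f) :
    ContDiff ℝ ∞ (partialD i f) ∧ HasCompactSupport (partialD i f) :=
  ⟨(hf.1.fderiv_right (m := ∞) (by simp)).clm_apply contDiff_const,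
    hf.2.fderiv_apply ℝ _⟩

theorem mderiv_good {n : ℕ} (α : Fin n → ℕ) {f : Eu n → ℝ}
    (hf : ContDiff ℝ ∞ f ∧ HasCompactSupport f) :
    ContDiff ℝ ∞ (mderiv α f) ∧ HasCompactSupport (mderiv α f) := by
  unfold mderiv
  induction List.finRange n with
  | nil => exact hf
  | cons i l ih =>
    simp only [List.foldr_cons]
    induction α i with
    | zero => exact ih
    | succ k ihk =>
      rw [Function.iterate_succ_apply']
      exact partialD_good i ihk

/-! ### Weak derivatives and the Sobolev spaces `H^k(J)` -/

/-- The space `L²(J)`. -/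
abbrev L2 {n : ℕ} (J : Set (Eu n)) : Type := Lp ℝ 2 (volume.restrict J)

/-- `w ∈ L²(J)` is the weak derivative `D^α u` of `u ∈ L²(J)`. -/
def IsWeakDeriv {n : ℕ} (J : Set (Eu n)) (α : Fin n → ℕ) (u w : L2 J) : Prop :=
  ∀ ψ : Eu n → ℝ, IsTest J ψ →
    ∫ x in J, u x * mderiv α ψ x = (-1) ^ (∑ i, α i) * ∫ x in J, w x * ψ x

theorem integrable_mul_good {n : ℕ} {J : Set (Eu n)} (u : L2 J) {g : Eu n → ℝ}
    (hg : ContDiff ℝ ∞ g ∧ HasCompactSupport g) :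
    Integrable (fun x => u x * g x) (volume.restrict J) :=
  have h : MemLp g 2 (volume.restrict J) := hg.1.continuous.memLp_of_hasCompactSupport hg.2
  (Lp.memLp u).integrable_mul h

theorem IsWeakDeriv.add {n : ℕ} {J : Set (Eu n)} {α : Fin n → ℕ} {u₁ u₂ w₁ w₂ : L2 J}
    (h₁ : IsWeakDeriv J α u₁ w₁) (h₂ : IsWeakDeriv J α u₂ w₂) :
    IsWeakDeriv J α (u₁ + u₂) (w₁ + w₂) := by
  intro ψ hψ
  have key : ∀ (a b : L2 J) (g : Eu n → ℝ), ContDiff ℝ ∞ g ∧ HasCompactSupport g →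
      ∫ x in J, (a + b) x * g x = (∫ x in J, a x * g x) + ∫ x in J, b x * g x := by
    intro a b g hg
    rw [← integral_add (integrable_mul_good a hg) (integrable_mul_good b hg)]
    refine integral_congr_ae ?_
    filter_upwards [Lp.coeFn_add a b] with x hx
    rw [hx, Pi.add_apply, add_mul]
  have hg : ContDiff ℝ ∞ ψ ∧ HasCompactSupport ψ := ⟨hψ.smooth, hψ.compact⟩
  rw [key _ _ _ (mderiv_good α hg), key _ _ _ hg, h₁ ψ hψ, h₂ ψ hψ, mul_add]

theorem IsWeakDeriv.smul {n : ℕ} {J : Set (Eu n)} {α : Fin n → ℕ} {u w : L2 J} (c : ℝ)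
    (h : IsWeakDeriv J α u w) : IsWeakDeriv J α (c • u) (c • w) := by
  intro ψ hψ
  have key : ∀ (a : L2 J) (g : Eu n → ℝ),
      ∫ x in J, (c • a) x * g x = c * ∫ x in J, a x * g x := by
    intro a g
    rw [← integral_const_mul]
    refine integral_congr_ae ?_
    filter_upwards [Lp.coeFn_smul c a] with x hx
    rw [hx, Pi.smul_apply, smul_eq_mul, mul_assoc]
  rw [key, key, h ψ hψ]
  ring

theorem IsWeakDeriv.zero {n : ℕ} {J : Set (Eu n)} (α : Fin n → ℕ) :
    IsWeakDeriv J α (0 : L2 J) 0 := by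
  intro ψ _
  have key : ∀ g : Eu n → ℝ, ∫ x in J, (0 : L2 J) x * g x = 0 := by
    intro g
    rw [← integral_zero (Eu n) ℝ (μ := volume.restrict J)]
    refine integral_congr_ae ?_
    filter_upwards [Lp.coeFn_zero ℝ 2 (volume.restrict J)] with x hx
    rw [hx, Pi.zero_apply, zero_mul]
  rw [key, key, mul_zero]

/-- The Sobolev space `H^k(J)`, as a subspace of `L²(J)`: all weak derivatives up to order `k`
exist in `L²(J)`. -/
def sobolev {n : ℕ} (k : ℕ) (J : Set (Eu n)) : Submodule ℝ (L2 J) where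
  carrier := {u | ∀ α ∈ multiIdx n k, ∃ w : L2 J, IsWeakDeriv J α u w}
  add_mem' := fun hu hv α hα =>
    let ⟨w, hw⟩ := hu α hα
    let ⟨z, hz⟩ := hv α hα
    ⟨w + z, hw.add hz⟩
  zero_mem' := fun α _ => ⟨0, IsWeakDeriv.zero α⟩
  smul_mem' := fun c _ hu α hα =>
    let ⟨w, hw⟩ := hu α hα
    ⟨c • w, hw.smul c⟩

open Classical in
/-- The weak derivative `D^α u ∈ L²(J)` (unique for open `J`; `0` if there is none). -/
def weakD {n : ℕ} (J : Set (Eu n)) (α : Fin n → ℕ) (u : L2 J) : L2 J :=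
  if h : ∃ w : L2 J, IsWeakDeriv J α u w then h.choose else 0

/-- The norm `(∑_{|α| ≤ k} ‖D^α u‖²_{L²(J)})^{1/2}` of `H^k(J)`. -/
def sobolevNorm {n : ℕ} (k : ℕ) (J : Set (Eu n)) (u : L2 J) : ℝ :=
  Real.sqrt (∑ α ∈ multiIdx n k, ‖weakD J α u‖ ^ 2)

/-! ### Polynomials -/

/-- `u ∈ L²(J)` is (the class of) the polynomial function `q` on `J`. -/
def IsPolyClass {n : ℕ} (J : Set (Eu n)) (q : MvPolynomial (Fin n) ℝ) (u : L2 J) : Prop :=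
  u =ᵐ[volume.restrict J] fun x => MvPolynomial.eval (fun i => x i) q

/-- The space `𝒫_p(J)` of polynomials of total degree at most `p`, as a subspace of
`H^k(J)`. -/
def polySpace {n : ℕ} (k p : ℕ) (J : Set (Eu n)) : Submodule ℝ (sobolev k J) where
  carrier := {u | ∃ q : MvPolynomial (Fin n) ℝ,
    q ∈ MvPolynomial.restrictTotalDegree (Fin n) ℝ p ∧ IsPolyClass J q (u : L2 J)}
  add_mem' := by
    rintro u v ⟨q, hq, hu⟩ ⟨r, hr, hv⟩
    refine ⟨q + r, Submodule.add_mem _ hq hr, ?_⟩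
    unfold IsPolyClass at hu hv ⊢
    filter_upwards [hu, hv, Lp.coeFn_add (u : L2 J) (v : L2 J)] with x h1 h2 h3
    rw [Submodule.coe_add, h3, Pi.add_apply, h1, h2, map_add]
  zero_mem' := by
    refine ⟨0, Submodule.zero_mem _, ?_⟩
    unfold IsPolyClass
    filter_upwards [Lp.coeFn_zero ℝ 2 (volume.restrict J)] with x hx
    rw [Submodule.coe_zero, hx, Pi.zero_apply, map_zero]
  smul_mem' := by
    rintro c u ⟨q, hq, hu⟩
    refine ⟨c • q, Submodule.smul_mem _ c hq, ?_⟩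
    unfold IsPolyClass at hu ⊢
    filter_upwards [hu, Lp.coeFn_smul c (u : L2 J)] with x h1 h2
    rw [Submodule.coe_smul, h2, Pi.smul_apply, h1, MvPolynomial.smul_eval, smul_eq_mul]

/-! ### Star-shaped domains -/

/-- `J` is star-shaped with respect to the ball `B(c, r) ⊆ J`: together with `x ∈ J` it contains
all segments from `x` to points of the ball. -/
structure IsStarBall {n : ℕ} (J : Set (Eu n)) (c : Eu n) (r : ℝ) : Prop where
  pos : 0 < r
  ball_subset : Metric.ball c r ⊆ J
  star : ∀ y ∈ Metric.ball c r, StarConvex ℝ y J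

/-- The chunkiness parameter `diam(J) / ρ_max`, where `ρ_max` is the supremum of the radii of the
balls with respect to which `J` is star-shaped. -/
def chunkiness {n : ℕ} (J : Set (Eu n)) : ℝ :=
  Metric.diam J / sSup {ρ : ℝ | ∃ c : Eu n, IsStarBall J c ρ}

/-! ### Averaged Taylor polynomials -/

/-- An admissible weight for the ball `B = B(c, r)`: `φ ∈ C_c^∞(ℝⁿ)`, `supp φ = closure B`,
`∫_B φ = 1`. -/
structure IsCutoff {n : ℕ} (c : Eu n) (r : ℝ) (φ : Eu n → ℝ) : Prop where
  smooth : ContDiff ℝ ∞ φ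
  supp : tsupport φ = Metric.closedBall c r
  integral : ∫ y in Metric.ball c r, φ y = 1

/-- The Taylor polynomial of order `p` of `v`, averaged over `B = B(c, r)` with weight `φ`:
`x ↦ ∑_{|α| ≤ p} (1/α!) ∫_B D^α v(y) (x - y)^α φ(y) dy`. -/
def avgTaylor {n : ℕ} (J : Set (Eu n)) (c : Eu n) (r : ℝ) (φ : Eu n → ℝ) (p : ℕ) (v : L2 J)
    (x : Eu n) : ℝ :=
  ∑ α ∈ multiIdx n p, (1 / ((∏ i, (α i).factorial : ℕ) : ℝ)) *
    ∫ y in Metric.ball c r, weakD J α v y * (∏ i, (x i - y i) ^ α i) * φ y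

/-! ### The wave equation -/

/-- `u ∈ L²(J)`, `J ⊆ ℝ^{d+1}` with coordinates `(x₁, …, x_d, t)`, satisfies
`∂²u/∂t² - ∇ · (a ∇ u) = 0` in `J` (in the sense of distributions), for a constant `a`. -/
def IsWaveSol {d : ℕ} (J : Set (Eu (d + 1))) (a : ℝ) (u : L2 J) : Prop :=
  ∀ ψ : Eu (d + 1) → ℝ, IsTest J ψ →
    ∫ x in J, u x * (partialD (Fin.last d) (partialD (Fin.last d) ψ) x
      - a * ∑ i : Fin d, partialD i.castSucc (partialD i.castSucc ψ) x) = 0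

/-! ### The properties of the projector -/

/-- `T` is the operator `Π^p : H^{p+1}(J) → H^{p+1}(J)` which sends `v` to its averaged Taylor
polynomial of order `p`. -/
def IsAvgTaylorOp {n : ℕ} (J : Set (Eu n)) (c : Eu n) (r : ℝ) (φ : Eu n → ℝ) (p : ℕ)
    (T : sobolev (p + 1) J →ₗ[ℝ] sobolev (p + 1) J) : Prop :=
  ∀ v : sobolev (p + 1) J,
    ((T v : L2 J) : Eu n → ℝ) =ᵐ[volume.restrict J] avgTaylor J c r φ p (v : L2 J)

/-- `T` is a projector of `H^{p+1}(J)` onto the space of all polynomials of degree at most `p`. -/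
def IsPolyProjector {n : ℕ} (J : Set (Eu n)) (p : ℕ)
    (T : sobolev (p + 1) J →ₗ[ℝ] sobolev (p + 1) J) : Prop :=
  LinearMap.IsProj (polySpace (p + 1) p J) T ∧
    ∀ q ∈ MvPolynomial.restrictTotalDegree (Fin n) ℝ p,
      ∃ u : sobolev (p + 1) J, IsPolyClass J q (u : L2 J)

/-- The bounds `‖D^β (v - T v)‖_J ≤ C diam(J)^{p+1-|β|} ‖v‖_{H^{p+1}(J)}`, `|β| ≤ p`. -/
def HasApproxBounds {n : ℕ} (J : Set (Eu n)) (p : ℕ)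
    (T : sobolev (p + 1) J →ₗ[ℝ] sobolev (p + 1) J) (C : ℝ) : Prop :=
  ∀ (v : sobolev (p + 1) J) (β : Fin n → ℕ), ∑ i, β i ≤ p →
    ‖weakD J β ((v - T v : sobolev (p + 1) J) : L2 J)‖ ≤
      C * Metric.diam J ^ (p + 1 - ∑ i, β i) * sobolevNorm (p + 1) J (v : L2 J)

/-- `T` maps solutions of the wave equation to solutions, for every constant `a > 0`. -/
def PreservesWaveSol {d : ℕ} (J : Set (Eu (d + 1))) (p : ℕ)
    (T : sobolev (p + 1) J →ₗ[ℝ] sobolev (p + 1) J) : Prop :=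
  ∀ (a : ℝ), 0 < a → ∀ v : sobolev (p + 1) J,
    IsWaveSol J a (v : L2 J) → IsWaveSol J a (T v : L2 J)

end Trefftz

end

namespace Trefftz

open scoped ENNReal Topology

/-! The proof works with families of functions indexed by multi-indices, playing the role of the
derivatives of one function. For such a family `g`, differentiating the averaged Taylor polynomial
`avgT` of order `p + 1` in direction `i` gives the one of order `p` of the shifted family `g (· +
eIdx i)` (`partialD_avgT_succ`), because differentiating `z^α / α!` lowers `α` by one. Hence `D^α
Π^p v = Π^(p-|α|) D^α v` (`mderiv_avgTaylor`), and everything else rests on this identity.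

Wave equation: the second derivatives of `Π^p v` are `Π^(p-2)` of second derivatives of `v`, so by
linearity the wave operator of `Π^p v` is an average of derivatives of the wave operator of `v`,
which vanish. For `p < 2` all second derivatives of `Π^p v` are zero.

Error bounds: by commutation it suffices to bound `w - Π^k w` in `L²` for `w = D^β v` and `k = p -
|β|`. For a smooth jet, `∫ φ = 1` turns the error into a `φ`-average of Taylor remainders along the
segments from `y ∈ B` to `x`, which lie in `J` by star-shapedness. The `L²` norm of this average is
controlled by `lintegral_segment_sq_le`: Cauchy-Schwarz, then for each fixed `s` the substitution `z
= y + s (x - y)`, in `x` if `s ≥ 1/2` and in `y` if `s ≤ 1/2`. The Jacobian factor never exceeds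
`2^n`, so no singular kernel is needed.

Sobolev functions are reached by density (`exists_isJet_eLpNorm_sub_le`): dilating towards the
centre of the ball leaves room to mollify inside `J`, so the derivatives converge in `L²` on all of
`J`. The resulting estimate `eLpNorm_sub_avgTaylor_le` has only derivatives of order `k + 1` on its
right side; for polynomials of degree at most `p` and `k = p` these vanish, so `Π^p` is a projector.

Chunkiness: with a ball of radius `r > ρ_max / 2` and a standard bump, `sup |φ|` scales like
`r^(-n)` while the geometric mean of `|B|` and `|J|` is bounded by `r^n` times a function of the
chunkiness, so `r` cancels. -/

/-! ### Calculus of multi-indices and classical derivatives -/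

/-- The multi-index of the partial derivative `∂ᵢ`. -/
abbrev eIdx {n : ℕ} (i : Fin n) : Fin n → ℕ := Pi.single i 1

theorem multiIndex_induction {n : ℕ} {P : (Fin n → ℕ) → Prop} (zero : P 0)
    (succ : ∀ β i, P β → P (β + eIdx i)) (α : Fin n → ℕ) : P α := by
  induction hm : ∑ i, α i generalizing α with
  | zero =>
    have : α = 0 := by
      funext i
      have := Finset.single_le_sum (f := α) (fun j _ => Nat.zero_le _) (Finset.mem_univ i)
      simp only [Pi.zero_apply]
      omega
    rwa [this]
  | succ m ih =>
    obtain ⟨i, hi⟩ : ∃ i, α i ≠ 0 := by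
      by_contra! h
      simp [h] at hm
    have hle : eIdx i ≤ α := by
      intro j
      by_cases h : j = i
      · subst h; simpa using Nat.one_le_iff_ne_zero.2 hi
      · simp [h]
    have hα : α - eIdx i + eIdx i = α := tsub_add_cancel_of_le hle
    rw [← hα]
    refine succ _ i (ih _ ?_)
    have h2 : ∑ j, (α - eIdx i + eIdx i) j = m + 1 := by rw [hα, hm]
    simpa [Finset.sum_add_distrib] using h2

theorem sum_single_one {n : ℕ} (i : Fin n) : ∑ j, eIdx i j = 1 := by
  simp

theorem sum_add_single {n : ℕ} (α : Fin n → ℕ) (i : Fin n) :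
    ∑ j, (α + eIdx i) j = ∑ j, α j + 1 := by
  simp [Finset.sum_add_distrib]

theorem contDiff_partialD {n : ℕ} {f : Eu n → ℝ} (hf : ContDiff ℝ ∞ f) (i : Fin n) :
    ContDiff ℝ ∞ (partialD i f) :=
  (hf.fderiv_right (m := ∞) (by simp)).clm_apply contDiff_const

theorem partialD_comm {n : ℕ} {f : Eu n → ℝ} (hf : ContDiff ℝ ∞ f) (i j : Fin n) :
    partialD i (partialD j f) = partialD j (partialD i f) := by
  funext x
  have hd : DifferentiableAt ℝ (fderiv ℝ f) x :=
    ((hf.fderiv_right (m := ∞) (by simp)).differentiable (by simp)).differentiableAt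
  have key : ∀ k l : Fin n, partialD k (partialD l f) x =
      fderiv ℝ (fderiv ℝ f) x (EuclideanSpace.single k 1) (EuclideanSpace.single l 1) := by
    intro k l
    unfold partialD
    rw [fderiv_clm_apply hd (differentiableAt_const _)]
    simp
  rw [key, key]
  exact (hf.contDiffAt.isSymmSndFDerivAt (by simpa using ENat.LEInfty.out)).eq _ _

theorem mderiv_zero {n : ℕ} (f : Eu n → ℝ) : mderiv 0 f = f := by
  unfold mderiv
  induction List.finRange n with
  | nil => rfl
  | cons i l ih => simp

theorem contDiff_iterate_partialD {n : ℕ} {f : Eu n → ℝ} (hf : ContDiff ℝ ∞ f) (i : Fin n)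
    (k : ℕ) : ContDiff ℝ ∞ ((partialD i)^[k] f) := by
  induction k with
  | zero => exact hf
  | succ k ih => rw [Function.iterate_succ_apply']; exact contDiff_partialD ih i

theorem contDiff_foldr_partialD {n : ℕ} {f : Eu n → ℝ} (hf : ContDiff ℝ ∞ f) (α : Fin n → ℕ)
    (l : List (Fin n)) : ContDiff ℝ ∞ (l.foldr (fun i g => (partialD i)^[α i] g) f) := by
  induction l with
  | nil => exact hf
  | cons i l ih => exact contDiff_iterate_partialD ih i _

theorem contDiff_mderiv {n : ℕ} {f : Eu n → ℝ} (hf : ContDiff ℝ ∞ f) (α : Fin n → ℕ) :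
    ContDiff ℝ ∞ (mderiv α f) :=
  contDiff_foldr_partialD hf α _

theorem partialD_iterate_comm {n : ℕ} {f : Eu n → ℝ} (hf : ContDiff ℝ ∞ f) (i j : Fin n)
    (k : ℕ) : partialD i ((partialD j)^[k] f) = (partialD j)^[k] (partialD i f) := by
  induction k with
  | zero => rfl
  | succ k ih =>
    rw [Function.iterate_succ_apply', Function.iterate_succ_apply',
      partialD_comm (contDiff_iterate_partialD hf j k), ih]

/-- The extra `∂ᵢ` commutes past the iterates of the other variables until it meets the block of
`∂ᵢ`. Since `l` has no duplicates, `α` and `α + eIdx i` agree on the rest of the list. -/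
theorem partialD_foldr {n : ℕ} {f : Eu n → ℝ} (hf : ContDiff ℝ ∞ f) (α : Fin n → ℕ) (i : Fin n)
    (l : List (Fin n)) (hl : l.Nodup) (hi : i ∈ l) :
    partialD i (l.foldr (fun i g => (partialD i)^[α i] g) f) =
      l.foldr (fun j g => (partialD j)^[(α + eIdx i) j] g) f := by
  induction l with
  | nil => simp at hi
  | cons j l ih =>
    rw [List.nodup_cons] at hl
    simp only [List.foldr_cons]
    by_cases hij : i = j
    · subst hij
      have h : l.foldr (fun j g => (partialD j)^[(α + eIdx i) j] g) f =
          l.foldr (fun i g => (partialD i)^[α i] g) f := by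
        refine List.foldr_ext _ _ _ fun j hj g => ?_
        have : j ≠ i := fun h => hl.1 (h ▸ hj)
        simp [this]
      rw [h]
      simp only [Pi.add_apply, Pi.single_eq_same]
      rw [Function.iterate_succ_apply']
    · have hi' : i ∈ l := by simpa [hij] using hi
      rw [partialD_iterate_comm (contDiff_foldr_partialD hf α l), ih hl.2 hi']
      simp [Ne.symm hij]

theorem partialD_mderiv {n : ℕ} {f : Eu n → ℝ} (hf : ContDiff ℝ ∞ f) (α : Fin n → ℕ)
    (i : Fin n) : partialD i (mderiv α f) = mderiv (α + eIdx i) f :=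
  partialD_foldr hf α i _ (List.nodup_finRange n) (List.mem_finRange i)

/-- A family of functions indexed by multi-indices and closed under partial derivatives consists
of derivatives of its members. -/
theorem mderiv_of_family {n : ℕ} (F : (Fin n → ℕ) → Eu n → ℝ)
    (hF : ∀ β i, partialD i (F β) = F (β + eIdx i)) (α β : Fin n → ℕ) :
    mderiv α (F β) = F (β + α) := by
  have hit : ∀ γ i k, (partialD i)^[k] (F γ) = F (γ + Pi.single i k) := by
    intro γ i k
    induction k with
    | zero => simp
    | succ k ih =>
      rw [Function.iterate_succ_apply', ih, hF, add_assoc, ← Pi.single_add]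
  have key : ∀ l : List (Fin n), l.foldr (fun i g => (partialD i)^[α i] g) (F β) =
      F (β + (l.map fun i => (Pi.single i (α i) : Fin n → ℕ)).sum) := by
    intro l
    induction l with
    | nil => simp
    | cons i l ih =>
      simp only [List.foldr_cons, List.map_cons, List.sum_cons]
      rw [ih, hit, add_assoc, add_comm _ (List.sum _)]
  unfold mderiv
  rw [key, ← List.ofFn_eq_map, List.sum_ofFn, Finset.univ_sum_single]

theorem mderiv_mderiv {n : ℕ} {f : Eu n → ℝ} (hf : ContDiff ℝ ∞ f) (α β : Fin n → ℕ) :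
    mderiv α (mderiv β f) = mderiv (β + α) f :=
  mderiv_of_family (fun γ => mderiv γ f) (fun γ i => partialD_mderiv hf γ i) α β

theorem mderiv_single {n : ℕ} {f : Eu n → ℝ} (hf : ContDiff ℝ ∞ f) (i : Fin n) :
    mderiv (eIdx i) f = partialD i f := by
  rw [← zero_add (eIdx i), ← partialD_mderiv hf, mderiv_zero]

theorem IsTest.partialD {n : ℕ} {J : Set (Eu n)} {ψ : Eu n → ℝ} (h : IsTest J ψ) (i : Fin n) :
    IsTest J (partialD i ψ) where
  smooth := contDiff_partialD h.smooth i
  compact := (partialD_good i ⟨h.smooth, h.compact⟩).2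
  supp := (tsupport_fderiv_apply_subset ℝ _).trans h.supp

theorem IsTest.mderiv {n : ℕ} {J : Set (Eu n)} {ψ : Eu n → ℝ} (h : IsTest J ψ)
    (α : Fin n → ℕ) : IsTest J (mderiv α ψ) := by
  induction α using multiIndex_induction with
  | zero => rwa [mderiv_zero]
  | succ β i ih => rw [← partialD_mderiv h.smooth]; exact ih.partialD i

theorem IsTest.eq_zero {n : ℕ} {J : Set (Eu n)} {ψ : Eu n → ℝ} (h : IsTest J ψ) {x : Eu n}
    (hx : x ∉ J) : ψ x = 0 :=
  image_eq_zero_of_notMem_tsupport fun hx' => hx (h.supp hx')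

/-- Integration by parts against a test function. -/
theorem setIntegral_mul_partialD {n : ℕ} {J : Set (Eu n)} {f ψ : Eu n → ℝ}
    (hf : ContDiff ℝ ∞ f) (hψ : IsTest J ψ) (i : Fin n) :
    ∫ x in J, f x * partialD i ψ x = -∫ x in J, partialD i f x * ψ x := by
  rw [setIntegral_eq_integral_of_forall_compl_eq_zero
      (fun x hx => by rw [(hψ.partialD i).eq_zero hx, mul_zero]),
    setIntegral_eq_integral_of_forall_compl_eq_zero
      (fun x hx => by rw [hψ.eq_zero hx, mul_zero])]
  have hint : ∀ g h : Eu n → ℝ, ContDiff ℝ ∞ g → IsTest J h →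
      Integrable (fun x => g x * h x) := fun g h hg hh =>
    (hg.continuous.mul hh.smooth.continuous).integrable_of_hasCompactSupport hh.compact.mul_left
  exact integral_mul_fderiv_eq_neg_fderiv_mul_of_integrable
    (hint _ _ (contDiff_partialD hf i) hψ) (hint _ _ hf (hψ.partialD i)) (hint _ _ hf hψ)
    (fun x _ => (hf.differentiable (by simp)).differentiableAt)
    (fun x _ => (hψ.smooth.differentiable (by simp)).differentiableAt)

theorem setIntegral_mul_mderiv {n : ℕ} {J : Set (Eu n)} {f ψ : Eu n → ℝ}
    (hf : ContDiff ℝ ∞ f) (hψ : IsTest J ψ) (α : Fin n → ℕ) :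
    ∫ x in J, f x * mderiv α ψ x = (-1) ^ (∑ i, α i) * ∫ x in J, mderiv α f x * ψ x := by
  induction α using multiIndex_induction generalizing ψ with
  | zero => simp [mderiv_zero]
  | succ β i ih =>
    rw [← partialD_mderiv hf, sum_add_single, pow_succ, add_comm β, ← mderiv_mderiv hψ.smooth,
      mderiv_single hψ.smooth, ih (hψ.partialD i),
      setIntegral_mul_partialD (contDiff_mderiv hf β) hψ]
    ring

/-! ### Weak derivatives -/

theorem locallyIntegrableOn_L2 {n : ℕ} {J : Set (Eu n)} (hJ : IsOpen J) (u : L2 J) :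
    LocallyIntegrableOn (u : Eu n → ℝ) J := by
  refine (locallyIntegrableOn_iff (hJ.isLocallyClosed)).2 fun K hK hKc => ?_
  have : IsFiniteMeasure (volume.restrict K) := ⟨by simpa using hKc.measure_lt_top⟩
  have h : MemLp u 2 (volume.restrict K) := (Lp.memLp u).mono_measure (Measure.restrict_mono hK le_rfl)
  exact h.integrable (by norm_num)

/-- The fundamental lemma of the calculus of variations, applied to `u - v`. It yields uniqueness of
weak derivatives. -/
theorem L2.ext_of_integral_test {n : ℕ} {J : Set (Eu n)} (hJ : IsOpen J) {u v : L2 J}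
    (h : ∀ ψ, IsTest J ψ → ∫ x in J, u x * ψ x = ∫ x in J, v x * ψ x) : u = v := by
  have hz : ∀ᵐ x, x ∈ J → (u - v : L2 J) x = 0 := by
    refine hJ.ae_eq_zero_of_integral_contDiff_smul_eq_zero (locallyIntegrableOn_L2 hJ _) ?_
    intro g hg hgc hgs
    have ht : IsTest J g := ⟨hg, hgc, hgs⟩
    have hg' : ContDiff ℝ ∞ g ∧ HasCompactSupport g := ⟨hg, hgc⟩
    rw [← setIntegral_eq_integral_of_forall_compl_eq_zero (s := J)
      (fun x hx => by rw [ht.eq_zero hx, zero_smul])]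
    have : ∫ x in J, g x • (u - v : L2 J) x = ∫ x in J, (u x * g x - v x * g x) := by
      refine integral_congr_ae ?_
      filter_upwards [Lp.coeFn_sub u v] with x hx
      rw [hx, Pi.sub_apply, smul_eq_mul]
      ring
    rw [this, integral_sub (integrable_mul_good u hg') (integrable_mul_good v hg'), h g ht,
      sub_self]
  refine sub_eq_zero.1 (Lp.ext ?_)
  filter_upwards [(ae_restrict_iff' hJ.measurableSet).2 hz, Lp.coeFn_zero ℝ 2 (volume.restrict J)]
    with x h1 h2
  rw [h1, h2, Pi.zero_apply]

theorem IsWeakDeriv.unique {n : ℕ} {J : Set (Eu n)} (hJ : IsOpen J) {α : Fin n → ℕ}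
    {u w z : L2 J} (hw : IsWeakDeriv J α u w) (hz : IsWeakDeriv J α u z) : w = z := by
  refine L2.ext_of_integral_test hJ fun ψ hψ => ?_
  have := (hw ψ hψ).symm.trans (hz ψ hψ)
  exact mul_left_cancel₀ (pow_ne_zero _ (by norm_num)) this

theorem IsWeakDeriv.weakD_eq {n : ℕ} {J : Set (Eu n)} (hJ : IsOpen J) {α : Fin n → ℕ}
    {u w : L2 J} (h : IsWeakDeriv J α u w) : weakD J α u = w := by
  have hex : ∃ w : L2 J, IsWeakDeriv J α u w := ⟨w, h⟩
  rw [weakD, dif_pos hex]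
  exact hex.choose_spec.unique hJ h

theorem isWeakDeriv_weakD {n k : ℕ} {J : Set (Eu n)} {α : Fin n → ℕ} {u : L2 J}
    (hu : u ∈ sobolev k J) (hα : ∑ i, α i ≤ k) : IsWeakDeriv J α u (weakD J α u) := by
  have hex := hu α (mem_multiIdx.2 hα)
  rw [weakD, dif_pos hex]
  exact hex.choose_spec

/-- `D^β ψ` is again a test function, so the definition of `w` may be tested with it; the sign
`(-1)^|α|` then cancels. -/
theorem IsWeakDeriv.of_add {n : ℕ} {J : Set (Eu n)} {α β : Fin n → ℕ} {u w z : L2 J}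
    (hw : IsWeakDeriv J α u w) (hz : IsWeakDeriv J (β + α) u z) : IsWeakDeriv J β w z := by
  intro ψ hψ
  have h1 := hw _ (hψ.mderiv β)
  have h2 := hz ψ hψ
  rw [mderiv_mderiv hψ.smooth, h2] at h1
  have hs : ∑ i, (β + α) i = ∑ i, β i + ∑ i, α i := by simp [Finset.sum_add_distrib]
  rw [hs, pow_add, mul_comm ((-1 : ℝ) ^ (∑ i, β i)), mul_assoc] at h1
  exact (mul_left_cancel₀ (pow_ne_zero _ (by norm_num)) h1).symm

theorem isWeakDeriv_weakD_weakD {n k : ℕ} {J : Set (Eu n)} {α β : Fin n → ℕ} {u : L2 J}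
    (hu : u ∈ sobolev k J) (h : ∑ i, α i + ∑ i, β i ≤ k) :
    IsWeakDeriv J β (weakD J α u) (weakD J (β + α) u) :=
  (isWeakDeriv_weakD hu (by omega)).of_add
    (isWeakDeriv_weakD hu (by simp only [Pi.add_apply, Finset.sum_add_distrib]; omega))

theorem weakD_weakD {n k : ℕ} {J : Set (Eu n)} (hJ : IsOpen J) {α β : Fin n → ℕ} {u : L2 J}
    (hu : u ∈ sobolev k J) (h : ∑ i, α i + ∑ i, β i ≤ k) :
    weakD J β (weakD J α u) = weakD J (β + α) u :=
  (isWeakDeriv_weakD_weakD hu h).weakD_eq hJ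

theorem weakD_mem_sobolev {n k l : ℕ} {J : Set (Eu n)} {α : Fin n → ℕ} {u : L2 J}
    (hu : u ∈ sobolev k J) (h : ∑ i, α i + l ≤ k) : weakD J α u ∈ sobolev l J := fun β hβ =>
  ⟨_, isWeakDeriv_weakD_weakD hu (by rw [mem_multiIdx] at hβ; omega)⟩

theorem weakD_zero {n : ℕ} {J : Set (Eu n)} (hJ : IsOpen J) (u : L2 J) : weakD J 0 u = u :=
  IsWeakDeriv.weakD_eq hJ fun ψ _ => by simp [mderiv_zero]

theorem weakD_add {n k : ℕ} {J : Set (Eu n)} (hJ : IsOpen J) {α : Fin n → ℕ} {u v : L2 J}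
    (hu : u ∈ sobolev k J) (hv : v ∈ sobolev k J) (hα : ∑ i, α i ≤ k) :
    weakD J α (u + v) = weakD J α u + weakD J α v :=
  ((isWeakDeriv_weakD hu hα).add (isWeakDeriv_weakD hv hα)).weakD_eq hJ

theorem weakD_smul {n k : ℕ} {J : Set (Eu n)} (hJ : IsOpen J) {α : Fin n → ℕ} {u : L2 J}
    (c : ℝ) (hu : u ∈ sobolev k J) (hα : ∑ i, α i ≤ k) :
    weakD J α (c • u) = c • weakD J α u :=
  ((isWeakDeriv_weakD hu hα).smul c).weakD_eq hJ

theorem weakD_sub {n k : ℕ} {J : Set (Eu n)} (hJ : IsOpen J) {α : Fin n → ℕ} {u v : L2 J}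
    (hu : u ∈ sobolev k J) (hv : v ∈ sobolev k J) (hα : ∑ i, α i ≤ k) :
    weakD J α (u - v) = weakD J α u - weakD J α v := by
  have h := weakD_add hJ ((sobolev k J).sub_mem hu hv) hv hα
  rw [sub_add_cancel] at h
  exact eq_sub_of_add_eq h.symm

/-! ### Smooth functions as elements of Sobolev spaces -/

theorem memLp_of_continuous_of_isBounded {n : ℕ} {J : Set (Eu n)} (hb : Bornology.IsBounded J)
    {f : Eu n → ℝ} (hf : Continuous f) : MemLp f 2 (volume.restrict J) := by
  have hc : IsCompact (closure J) := hb.isCompact_closure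
  have : IsFiniteMeasure (volume.restrict (closure J)) := ⟨by simpa using hc.measure_lt_top⟩
  obtain ⟨C, hC⟩ := hc.exists_bound_of_continuousOn hf.continuousOn
  have h : MemLp f 2 (volume.restrict (closure J)) :=
    MemLp.of_bound hf.aestronglyMeasurable C
      ((ae_restrict_iff' isClosed_closure.measurableSet).2 (.of_forall hC))
  exact h.mono_measure (Measure.restrict_mono subset_closure le_rfl)

theorem isWeakDeriv_of_contDiff {n : ℕ} {J : Set (Eu n)} {f : Eu n → ℝ} (hf : ContDiff ℝ ∞ f)
    {α : Fin n → ℕ} {u w : L2 J} (hu : u =ᵐ[volume.restrict J] f)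
    (hw : w =ᵐ[volume.restrict J] mderiv α f) : IsWeakDeriv J α u w := by
  intro ψ hψ
  have h1 : ∫ x in J, u x * mderiv α ψ x = ∫ x in J, f x * mderiv α ψ x :=
    integral_congr_ae (by filter_upwards [hu] with x hx; rw [hx])
  have h2 : ∫ x in J, w x * ψ x = ∫ x in J, mderiv α f x * ψ x :=
    integral_congr_ae (by filter_upwards [hw] with x hx; rw [hx])
  rw [h1, h2, setIntegral_mul_mderiv hf hψ]

theorem weakD_of_contDiff {n : ℕ} {J : Set (Eu n)} (hJ : IsOpen J) (hb : Bornology.IsBounded J)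
    {f : Eu n → ℝ} (hf : ContDiff ℝ ∞ f) (α : Fin n → ℕ) {u : L2 J}
    (hu : u =ᵐ[volume.restrict J] f) :
    weakD J α u =
      (memLp_of_continuous_of_isBounded hb (contDiff_mderiv hf α).continuous).toLp :=
  (isWeakDeriv_of_contDiff hf hu (MemLp.coeFn_toLp _)).weakD_eq hJ

theorem mem_sobolev_of_contDiff {n : ℕ} {J : Set (Eu n)} (hb : Bornology.IsBounded J)
    {f : Eu n → ℝ} (hf : ContDiff ℝ ∞ f) (k : ℕ) {u : L2 J} (hu : u =ᵐ[volume.restrict J] f) :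
    u ∈ sobolev k J := fun α _ =>
  ⟨(memLp_of_continuous_of_isBounded hb (contDiff_mderiv hf α).continuous).toLp,
    isWeakDeriv_of_contDiff hf hu (MemLp.coeFn_toLp _)⟩

/-! ### Monomials -/

/-- The monomial `z ↦ z^α`. -/
noncomputable def mono {n : ℕ} (α : Fin n → ℕ) (z : Eu n) : ℝ := ∏ i, z i ^ α i

/-- The factorial `α!` of a multi-index, as a real number. -/
noncomputable def mfact {n : ℕ} (α : Fin n → ℕ) : ℝ := ((∏ i, (α i).factorial : ℕ) : ℝ)

theorem mfact_pos {n : ℕ} (α : Fin n → ℕ) : 0 < mfact α :=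
  Nat.cast_pos.2 (Finset.prod_pos fun _ _ => Nat.factorial_pos _)

theorem one_le_mfact {n : ℕ} (α : Fin n → ℕ) : 1 ≤ mfact α :=
  Nat.one_le_cast.2 (Finset.prod_pos fun _ _ => Nat.factorial_pos _)

theorem mono_zero {n : ℕ} (z : Eu n) : mono 0 z = 1 := by simp [mono]

theorem mono_add_eIdx {n : ℕ} (α : Fin n → ℕ) (i : Fin n) (z : Eu n) :
    mono (α + eIdx i) z = z i * mono α z := by
  unfold mono
  simp only [Pi.add_apply, pow_add, Finset.prod_mul_distrib, mul_comm (z i)]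
  congr 1
  rw [Finset.prod_eq_single i (fun j _ hj => by simp [hj]) (by simp)]
  simp

theorem mfact_add_eIdx {n : ℕ} (α : Fin n → ℕ) (i : Fin n) :
    mfact (α + eIdx i) = (α i + 1) * mfact α := by
  unfold mfact
  rw [← Finset.mul_prod_erase _ _ (Finset.mem_univ i), ← Finset.mul_prod_erase _
    (fun j => (α j).factorial) (Finset.mem_univ i)]
  have : ∏ j ∈ Finset.univ.erase i, ((α + eIdx i) j).factorial =
      ∏ j ∈ Finset.univ.erase i, (α j).factorial :=
    Finset.prod_congr rfl fun j hj => by simp [Finset.ne_of_mem_erase hj]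
  rw [this]
  simp only [Pi.add_apply, Pi.single_eq_same, Nat.factorial_succ]
  push_cast
  ring

theorem mono_smul {n : ℕ} (α : Fin n → ℕ) (t : ℝ) (z : Eu n) :
    mono α (t • z) = t ^ (∑ i, α i) * mono α z := by
  simp [mono, mul_pow, Finset.prod_mul_distrib, Finset.prod_pow_eq_pow_sum]

theorem abs_mono_le {n : ℕ} (α : Fin n → ℕ) (z : Eu n) :
    |mono α z| ≤ ‖z‖ ^ (∑ i, α i) := by
  unfold mono
  rw [Finset.abs_prod, ← Finset.prod_pow_eq_pow_sum]
  refine Finset.prod_le_prod (fun i _ => abs_nonneg _) fun i _ => ?_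
  rw [abs_pow]
  exact pow_le_pow_left₀ (abs_nonneg _) (PiLp.norm_apply_le z i) _

theorem contDiff_mono {n : ℕ} (α : Fin n → ℕ) : ContDiff ℝ ∞ (mono α) := by
  unfold mono
  fun_prop

/-- The truncated subtraction `α - eIdx i` is harmless: where `α i = 0` the factor `α i` vanishes.
-/
theorem partialD_mono {n : ℕ} (α : Fin n → ℕ) (i : Fin n) (z : Eu n) :
    partialD i (mono α) z = α i * mono (α - eIdx i) z := by
  have h : HasFDerivAt (mono α) (∑ j, (∏ k ∈ Finset.univ.erase j, z k ^ α k) •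
      ((α j * z j ^ (α j - 1)) • (EuclideanSpace.proj j : Eu n →L[ℝ] ℝ))) z := by
    unfold mono
    refine HasFDerivAt.finsetProd fun j _ => ?_
    have := ((EuclideanSpace.proj j : Eu n →L[ℝ] ℝ).hasFDerivAt (x := z)).pow (α j)
    simpa using this
  unfold partialD
  rw [h.fderiv]
  simp only [sum_apply, smul_apply, smul_eq_mul, PiLp.proj_apply, PiLp.single_apply]
  rw [Finset.sum_eq_single i (fun j _ hj => by simp [hj]) (by simp)]
  unfold mono
  rw [← Finset.mul_prod_erase _ (fun j => z j ^ (α - eIdx i) j) (Finset.mem_univ i)]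
  have : ∏ j ∈ Finset.univ.erase i, z j ^ (α - eIdx i) j = ∏ j ∈ Finset.univ.erase i, z j ^ α j :=
    Finset.prod_congr rfl fun j hj => by simp [Finset.ne_of_mem_erase hj]
  rw [this]
  simp
  ring

/-- The binomial theorem in each coordinate. It separates the variables in `(x - y)^α`, so that
integrating in `y` leaves a polynomial in `x`. -/
theorem mono_add {n : ℕ} (α : Fin n → ℕ) (x y : Eu n) :
    mono α (x + y) = ∑ m ∈ Fintype.piFinset fun i => Finset.range (α i + 1),
      (∏ i, (y i ^ (α i - m i) * (α i).choose (m i))) * mono m x := by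
  unfold mono
  simp only [PiLp.add_apply, add_pow]
  rw [Finset.prod_univ_sum]
  refine Finset.sum_congr rfl fun m _ => ?_
  rw [← Finset.prod_mul_distrib]
  exact Finset.prod_congr rfl fun i _ => by ring

theorem multiIdx_zero (n : ℕ) : multiIdx n 0 = {0} := by
  ext α
  rw [mem_multiIdx, Finset.mem_singleton]
  constructor
  · intro h
    funext i
    have := Finset.single_le_sum (f := α) (fun j _ => Nat.zero_le _) (Finset.mem_univ i)
    simp only [Pi.zero_apply]
    omega
  · rintro rfl
    simp

/-- The substitution `α = β + eIdx i` reaches exactly the indices with `α i ≠ 0`. It is applied to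
summands with a factor `α i`, as produced by differentiating monomials. -/
theorem sum_multiIdx_succ_eq {n k : ℕ} (i : Fin n) (h : (Fin n → ℕ) → ℝ)
    (h0 : ∀ α, α i = 0 → h α = 0) :
    ∑ α ∈ multiIdx n (k + 1), h α = ∑ β ∈ multiIdx n k, h (β + eIdx i) := by
  symm
  refine Finset.sum_of_injOn (· + eIdx i) (fun a _ b _ hab => add_right_cancel hab) ?_ ?_ ?_
  · intro β hβ
    rw [Finset.mem_coe, mem_multiIdx] at *
    rw [sum_add_single]
    omega
  · intro α hα hα'
    apply h0
    by_contra hi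
    have hle : eIdx i ≤ α := by
      intro j
      by_cases h : j = i
      · subst h; simpa using Nat.one_le_iff_ne_zero.2 hi
      · simp [h]
    refine hα' ⟨α - eIdx i, ?_, tsub_add_cancel_of_le hle⟩
    rw [mem_multiIdx] at hα
    rw [Finset.mem_coe, mem_multiIdx]
    have := sum_add_single (α - eIdx i) i
    rw [tsub_add_cancel_of_le hle] at this
    omega
  · intro β _
    rfl

/-! ### Polynomials as smooth functions -/

theorem contDiff_eval {n : ℕ} (q : MvPolynomial (Fin n) ℝ) :
    ContDiff ℝ ∞ fun x : Eu n => MvPolynomial.eval (fun i => x i) q := by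
  induction q using MvPolynomial.induction_on with
  | C a => simpa using contDiff_const
  | add p q hp hq => simpa using hp.add hq
  | mul_X p i hp =>
    simp only [map_mul, MvPolynomial.eval_X]
    exact hp.mul (by fun_prop)

theorem eval_finsupp_prod {n : ℕ} (m : Fin n → ℕ) (x : Eu n) :
    MvPolynomial.eval (fun i => x i) (∏ i, MvPolynomial.X i ^ m i : MvPolynomial (Fin n) ℝ) =
      mono m x := by
  simp [mono]

/-! ### Differentiation under the integral sign -/

section Parametric

variable {n : ℕ} {B : Set (Eu n)} {w : Eu n → ℝ} {K : Eu n → Eu n → ℝ}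

theorem integrableOn_mul_of_continuous (hB : Bornology.IsBounded B) (hBm : MeasurableSet B)
    (hw : IntegrableOn w B) {h : Eu n → ℝ} (hh : Continuous h) :
    IntegrableOn (fun y => w y * h y) B :=
  hw.mul_continuousOn_of_subset hh.continuousOn hBm hB.isCompact_closure subset_closure

theorem continuous_fderiv_left (hK : ContDiff ℝ 1 (Function.uncurry K)) :
    Continuous fun z : Eu n × Eu n => fderiv ℝ (fun x => K x z.2) z.1 := by
  have : (fun z : Eu n × Eu n => fderiv ℝ (fun x => K x z.2) z.1) = fun z =>
      (fderiv ℝ (Function.uncurry K) z).comp (ContinuousLinearMap.inl ℝ (Eu n) (Eu n)) := by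
    funext z
    have h1 : HasFDerivAt (Function.uncurry K) (fderiv ℝ (Function.uncurry K) z) (z.1, z.2) :=
      (hK.differentiable one_ne_zero z).hasFDerivAt
    exact (HasFDerivAt.comp (f := fun x => (x, z.2)) z.1 h1
      (hasFDerivAt_prodMk_left z.1 z.2)).fderiv
  rw [this]
  exact (hK.continuous_fderiv one_ne_zero).clm_comp continuous_const

theorem hasFDerivAt_setIntegral_mul (hB : Bornology.IsBounded B) (hBm : MeasurableSet B)
    (hw : IntegrableOn w B) (hK : ContDiff ℝ 1 (Function.uncurry K)) (x : Eu n) :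
    HasFDerivAt (fun x => ∫ y in B, w y * K x y)
      (∫ y in B, w y • fderiv ℝ (fun x => K x y) x) x := by
  have hKy : ∀ y, ContDiff ℝ 1 fun x => K x y := fun y =>
    hK.comp (contDiff_id.prodMk contDiff_const)
  have hcont := continuous_fderiv_left hK
  -- The derivative of the kernel is bounded on a compact set containing all relevant pairs, so `|w|
  -- * C` is an integrable majorant near `x`.
  obtain ⟨C, hC⟩ := ((isCompact_closedBall x 1).prod
    hB.isCompact_closure).exists_bound_of_continuousOn hcont.continuousOn
  refine hasFDerivAt_integral_of_dominated_of_fderiv_le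
    (bound := fun y => |w y| * C) (F' := fun x y => w y • fderiv ℝ (fun x => K x y) x)
    (Metric.ball_mem_nhds x one_pos) ?_ ?_ ?_ ?_ ?_ ?_
  · refine .of_forall fun z => ?_
    exact hw.aestronglyMeasurable.mul
      (hK.continuous.comp (by fun_prop : Continuous fun y : Eu n => (z, y))).aestronglyMeasurable
  · exact integrableOn_mul_of_continuous hB hBm hw
      (hK.continuous.comp (by fun_prop : Continuous fun y : Eu n => (x, y)))
  · exact hw.aestronglyMeasurable.smul
      (hcont.comp (by fun_prop : Continuous fun y : Eu n => (x, y))).aestronglyMeasurable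
  · refine (ae_restrict_iff' hBm).2 (.of_forall fun y hy z hz => ?_)
    rw [norm_smul, Real.norm_eq_abs]
    exact mul_le_mul_of_nonneg_left
      (hC (z, y) ⟨Metric.ball_subset_closedBall hz, subset_closure hy⟩) (abs_nonneg _)
  · exact hw.abs.mul_const C
  · refine .of_forall fun y z _ => ?_
    exact (((hKy y).differentiable one_ne_zero z).hasFDerivAt).const_mul (w y)

theorem partialD_setIntegral_mul (hB : Bornology.IsBounded B) (hBm : MeasurableSet B)
    (hw : IntegrableOn w B) (hK : ContDiff ℝ 1 (Function.uncurry K)) (i : Fin n) (x : Eu n) :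
    partialD i (fun x => ∫ y in B, w y * K x y) x =
      ∫ y in B, w y * partialD i (fun x => K x y) x := by
  unfold partialD
  rw [(hasFDerivAt_setIntegral_mul hB hBm hw hK x).fderiv]
  by_cases hi : IntegrableOn (fun y => w y • fderiv ℝ (fun x => K x y) x) B
  · rw [ContinuousLinearMap.integral_apply hi]
    simp
  · exfalso
    apply hi
    exact hw.smul_continuousOn_of_subset
      ((continuous_fderiv_left hK).comp
        (by fun_prop : Continuous fun y : Eu n => (x, y))).continuousOn hBm
      hB.isCompact_closure subset_closure

end Parametric

/-! ### Averaged Taylor polynomials of jets -/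

/-- The averaged Taylor polynomial of a family of functions `g α`, which take the role of the
derivatives `D^α v`. -/
noncomputable def avgT {n : ℕ} (c : Eu n) (r : ℝ) (φ : Eu n → ℝ) (p : ℕ)
    (g : (Fin n → ℕ) → Eu n → ℝ) (x : Eu n) : ℝ :=
  ∑ α ∈ multiIdx n p, (1 / mfact α) *
    ∫ y in Metric.ball c r, g α y * φ y * mono α (x - y)

/-- The weak derivatives enter only as a family of functions, so they may be replaced by shifted
families or by smooth approximations. -/
theorem avgTaylor_eq_avgT {n : ℕ} (J : Set (Eu n)) (c : Eu n) (r : ℝ) (φ : Eu n → ℝ) (p : ℕ)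
    (v : L2 J) : avgTaylor J c r φ p v = avgT c r φ p fun α => weakD J α v := by
  funext x
  unfold avgTaylor avgT mfact mono
  refine Finset.sum_congr rfl fun α _ => ?_
  congr 2
  funext y
  simp only [PiLp.sub_apply]
  ring

section AvgT

variable {n p : ℕ} {c : Eu n} {r : ℝ} {φ : Eu n → ℝ} {g : (Fin n → ℕ) → Eu n → ℝ}

theorem avgT_congr {g' : (Fin n → ℕ) → Eu n → ℝ}
    (h : ∀ α, ∑ i, α i ≤ p → ∀ᵐ y ∂volume.restrict (Metric.ball c r), g α y = g' α y) :
    avgT c r φ p g = avgT c r φ p g' := by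
  funext x
  unfold avgT
  refine Finset.sum_congr rfl fun α hα => ?_
  congr 1
  refine integral_congr_ae ?_
  filter_upwards [h α (mem_multiIdx.1 hα)] with y hy
  rw [hy]

theorem integrableOn_mul_mono {w : Eu n → ℝ} (hw : IntegrableOn w (Metric.ball c r))
    (α : Fin n → ℕ) (x : Eu n) :
    IntegrableOn (fun y => w y * mono α (x - y)) (Metric.ball c r) :=
  integrableOn_mul_of_continuous Metric.isBounded_ball measurableSet_ball hw
    ((contDiff_mono α).continuous.comp (by fun_prop))

theorem avgT_add {g' : (Fin n → ℕ) → Eu n → ℝ}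
    (hg : ∀ α, ∑ i, α i ≤ p → IntegrableOn (fun y => g α y * φ y) (Metric.ball c r))
    (hg' : ∀ α, ∑ i, α i ≤ p → IntegrableOn (fun y => g' α y * φ y) (Metric.ball c r)) :
    avgT c r φ p (g + g') = avgT c r φ p g + avgT c r φ p g' := by
  funext x
  rw [Pi.add_apply]
  unfold avgT
  rw [← Finset.sum_add_distrib]
  refine Finset.sum_congr rfl fun α hα => ?_
  rw [mem_multiIdx] at hα
  rw [← mul_add, ← integral_add (integrableOn_mul_mono (hg α hα) α x)
    (integrableOn_mul_mono (hg' α hα) α x)]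
  simp only [Pi.add_apply, add_mul]

theorem avgT_const_smul (a : ℝ) : avgT c r φ p (a • g) = a • avgT c r φ p g := by
  funext x
  rw [Pi.smul_apply, smul_eq_mul]
  unfold avgT
  rw [Finset.mul_sum]
  refine Finset.sum_congr rfl fun α _ => ?_
  simp only [Pi.smul_apply, smul_eq_mul, mul_assoc]
  rw [integral_const_mul]
  ring

/-- Expanding `(x - y)^α` moves the integrals into the coefficients; the exponents `m` of `x`
satisfy `m ≤ α`, whence the degree bound. -/
theorem exists_polynomial_avgT
    (hg : ∀ α, ∑ i, α i ≤ p → IntegrableOn (fun y => g α y * φ y) (Metric.ball c r)) :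
    ∃ q ∈ MvPolynomial.restrictTotalDegree (Fin n) ℝ p,
      ∀ x : Eu n, avgT c r φ p g x = MvPolynomial.eval (fun i => x i) q := by
  refine ⟨∑ α ∈ multiIdx n p, ∑ m ∈ Fintype.piFinset fun i => Finset.range (α i + 1),
    MvPolynomial.C ((1 / mfact α) * ∫ y in Metric.ball c r, g α y * φ y *
      ∏ i, ((-y) i ^ (α i - m i) * (α i).choose (m i))) * ∏ i, MvPolynomial.X i ^ m i, ?_, ?_⟩
  · refine Submodule.sum_mem _ fun α hα => Submodule.sum_mem _ fun m hm => ?_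
    rw [MvPolynomial.mem_restrictTotalDegree]
    rw [mem_multiIdx] at hα
    refine (MvPolynomial.totalDegree_mul _ _).trans ?_
    rw [MvPolynomial.totalDegree_C, zero_add]
    refine (MvPolynomial.totalDegree_finsetProd _ _).trans (le_trans ?_ hα)
    refine Finset.sum_le_sum fun i _ => ?_
    rw [MvPolynomial.totalDegree_X_pow]
    have := Fintype.mem_piFinset.1 hm i
    rw [Finset.mem_range] at this
    omega
  · intro x
    unfold avgT
    simp only [map_sum, map_mul, MvPolynomial.eval_C, eval_finsupp_prod]
    refine Finset.sum_congr rfl fun α hα => ?_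
    simp only [sub_eq_add_neg, mono_add, Finset.mul_sum]
    rw [integral_finsetSum, Finset.mul_sum]
    · refine Finset.sum_congr rfl fun m _ => ?_
      simp only [← mul_assoc]
      rw [integral_mul_const]
      ring
    · intro m _
      simp only [← mul_assoc]
      exact (integrableOn_mul_of_continuous Metric.isBounded_ball measurableSet_ball
        (hg α (mem_multiIdx.1 hα)) (by fun_prop)).mul_const _

theorem contDiff_avgT
    (hg : ∀ α, ∑ i, α i ≤ p → IntegrableOn (fun y => g α y * φ y) (Metric.ball c r)) :
    ContDiff ℝ ∞ (avgT c r φ p g) := by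
  obtain ⟨q, -, hq⟩ := exists_polynomial_avgT hg
  rw [funext hq]
  exact contDiff_eval q

theorem partialD_avgT_zero (i : Fin n) : partialD i (avgT c r φ 0 g) = 0 := by
  funext x
  unfold partialD avgT
  simp [multiIdx_zero, mono_zero]

/-- Differentiation under the integral turns `z^α / α!` into `z^(α - eIdx i) / (α - eIdx i)!` or
zero. Reindexing by `β = α - eIdx i` moves the shift onto the family. -/
theorem partialD_avgT_succ
    (hg : ∀ α, ∑ i, α i ≤ p + 1 → IntegrableOn (fun y => g α y * φ y) (Metric.ball c r))
    (i : Fin n) :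
    partialD i (avgT c r φ (p + 1) g) = avgT c r φ p fun α => g (α + eIdx i) := by
  funext x
  have hK : ∀ α : Fin n → ℕ, ContDiff ℝ 1 (Function.uncurry fun x y : Eu n => mono α (x - y)) :=
    fun α => ((contDiff_mono α).of_le (by simp)).comp (by fun_prop)
  have hd : ∀ α ∈ multiIdx n (p + 1), DifferentiableAt ℝ (fun x => (1 / mfact α) *
      ∫ y in Metric.ball c r, g α y * φ y * mono α (x - y)) x := fun α hα =>
    (hasFDerivAt_setIntegral_mul Metric.isBounded_ball measurableSet_ball
      (hg α (mem_multiIdx.1 hα)) (hK α) x).differentiableAt.const_mul _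
  have h1 : partialD i (avgT c r φ (p + 1) g) x = ∑ α ∈ multiIdx n (p + 1), (1 / mfact α) *
      ∫ y in Metric.ball c r, g α y * φ y * (α i * mono (α - eIdx i) (x - y)) := by
    unfold partialD
    have : avgT c r φ (p + 1) g = fun x => ∑ α ∈ multiIdx n (p + 1), (1 / mfact α) *
      ∫ y in Metric.ball c r, g α y * φ y * mono α (x - y) := rfl
    rw [this, fderiv_fun_sum hd, sum_apply]
    refine Finset.sum_congr rfl fun α hα => ?_
    rw [fderiv_const_mul (hasFDerivAt_setIntegral_mul Metric.isBounded_ball measurableSet_ball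
      (hg α (mem_multiIdx.1 hα)) (hK α) x).differentiableAt, smul_apply,
      smul_eq_mul]
    congr 1
    have h2 := partialD_setIntegral_mul Metric.isBounded_ball measurableSet_ball
      (hg α (mem_multiIdx.1 hα)) (hK α) i x
    refine h2.trans ?_
    congr 1
    funext y
    rw [← partialD_mono]
    congr 1
    unfold partialD
    rw [fderiv_comp_sub (f := mono α) y]
  rw [h1, sum_multiIdx_succ_eq i _ fun α hα => by simp [hα]]
  unfold avgT
  refine Finset.sum_congr rfl fun β _ => ?_
  rw [add_tsub_cancel_right, mfact_add_eIdx]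
  simp only [mul_left_comm _ (((β + eIdx i) i : ℕ) : ℝ)]
  rw [integral_const_mul, ← mul_assoc]
  congr 1
  have := (mfact_pos β).ne'
  simp only [Pi.add_apply, Pi.single_eq_same]
  push_cast
  field_simp

theorem mderiv_avgT
    (hg : ∀ α, ∑ i, α i ≤ p → IntegrableOn (fun y => g α y * φ y) (Metric.ball c r))
    (α : Fin n → ℕ) :
    mderiv α (avgT c r φ p g) =
      if ∑ i, α i ≤ p then avgT c r φ (p - ∑ i, α i) fun β => g (β + α) else 0 := by
  -- The claimed right-hand sides, with zero beyond order `p`, form a family closed under partial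
  -- derivatives, so it suffices to check a single `∂ᵢ`.
  have h := mderiv_of_family (fun α => if ∑ i, α i ≤ p then
    avgT c r φ (p - ∑ i, α i) fun β => g (β + α) else 0) ?_ α 0
  · simpa using h
  intro β i
  rw [sum_add_single]
  split_ifs with h1 h2 h2
  · obtain ⟨k, hk⟩ : ∃ k, p - ∑ i, β i = k + 1 := ⟨p - ∑ i, β i - 1, by omega⟩
    rw [hk, partialD_avgT_succ]
    · have : p - (∑ i, β i + 1) = k := by omega
      rw [this]
      congr 1
      funext γ
      rw [add_assoc, add_comm (eIdx i)]
    · intro γ hγ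
      refine hg _ ?_
      simp only [Pi.add_apply, Finset.sum_add_distrib]
      omega
  · have : p - ∑ i, β i = 0 := by omega
    rw [this, partialD_avgT_zero]
  · omega
  · funext x
    simp [partialD]

end AvgT

/-! ### Lower Lebesgue integrals -/

theorem sq_lintegral_mul_le {α : Type*} [MeasurableSpace α] (μ : Measure α) {f g : α → ℝ≥0∞}
    (hf : AEMeasurable f μ) (hg : AEMeasurable g μ) :
    (∫⁻ a, f a * g a ∂μ) ^ 2 ≤ (∫⁻ a, f a ^ 2 ∂μ) * ∫⁻ a, g a ^ 2 ∂μ := by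
  have h := ENNReal.lintegral_mul_le_Lp_mul_Lq μ Real.HolderConjugate.two_two hf hg
  have hs : ∀ a : ℝ≥0∞, (a ^ (1 / 2 : ℝ)) ^ 2 = a := fun a => by
    rw [← ENNReal.rpow_natCast, ← ENNReal.rpow_mul]
    norm_num
  calc (∫⁻ a, f a * g a ∂μ) ^ 2
      ≤ ((∫⁻ a, f a ^ (2 : ℝ) ∂μ) ^ (1 / 2 : ℝ) * (∫⁻ a, g a ^ (2 : ℝ) ∂μ) ^ (1 / 2 : ℝ)) ^ 2 :=
        pow_le_pow_left' h 2
    _ = _ := by rw [mul_pow, hs, hs]; simp only [ENNReal.rpow_two]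

theorem sq_lintegral_le {α : Type*} [MeasurableSpace α] (μ : Measure α) {f : α → ℝ≥0∞}
    (hf : AEMeasurable f μ) : (∫⁻ a, f a ∂μ) ^ 2 ≤ μ Set.univ * ∫⁻ a, f a ^ 2 ∂μ := by
  have := sq_lintegral_mul_le μ (f := fun _ => 1) aemeasurable_const hf
  simpa using this

theorem eLpNorm_two_sq {α : Type*} [MeasurableSpace α] (μ : Measure α) (f : α → ℝ) :
    eLpNorm f 2 μ ^ 2 = ∫⁻ x, ‖f x‖ₑ ^ 2 ∂μ := by
  have := eLpNorm_nnreal_pow_eq_lintegral (f := f) (μ := μ) (p := 2) (by norm_num)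
  simpa [ENNReal.rpow_two] using this

theorem lintegral_comp_smul_add {n : ℕ} {H : Eu n → ℝ≥0∞} (hH : Measurable H) {s : ℝ} (hs : 0 < s)
    (b : Eu n) : ∫⁻ x, H (s • x + b) = ENNReal.ofReal ((s ^ n)⁻¹) * ∫⁻ x, H x := by
  have h1 : ∫⁻ x, H (s • x + b) = ∫⁻ x, H (x + b) ∂(Measure.map (s • ·) volume) := by
    rw [lintegral_map (by fun_prop) (by fun_prop)]
  rw [h1, Measure.map_addHaar_smul _ hs.ne', lintegral_smul_measure, lintegral_add_right_eq_self,
    abs_of_nonneg (by positivity), finrank_euclideanSpace_fin, smul_eq_mul]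

theorem lintegral_comp_smul_add_le {n : ℕ} {H : Eu n → ℝ≥0∞} (hH : Measurable H) {s : ℝ}
    (hs : 1 / 2 ≤ s) (b : Eu n) : ∫⁻ x, H (s • x + b) ≤ 2 ^ n * ∫⁻ x, H x := by
  rw [lintegral_comp_smul_add hH (by linarith)]
  gcongr
  rw [← inv_pow, ENNReal.ofReal_pow (by positivity)]
  gcongr
  rw [← ENNReal.ofReal_ofNat]
  apply ENNReal.ofReal_le_ofReal
  rw [inv_le_comm₀ (by linarith) (by norm_num)]
  linarith

/-- The basic estimate for averages over segments which join points of `J` to points of `B`. -/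
theorem lintegral_segment_sq_le {n : ℕ} {J B : Set (Eu n)} (hJ : MeasurableSet J)
    (hB : MeasurableSet B) (hBJ : B ⊆ J) (hBf : volume B ≠ ⊤)
    (hseg : ∀ x ∈ J, ∀ y ∈ B, ∀ s ∈ Set.Ioc (0 : ℝ) 1, y + s • (x - y) ∈ J)
    {G : Eu n → ℝ≥0∞} (hG : Measurable G) :
    ∫⁻ x in J, (∫⁻ y in B, ∫⁻ s in Set.Ioc (0 : ℝ) 1, G (y + s • (x - y))) ^ 2 ≤
      2 ^ n * (volume B * volume J) * ∫⁻ z in J, G z ^ 2 := by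
  -- Cutting off by the indicator of `J` allows integrals over `J` or `B` to be enlarged to the
  -- whole space, where the affine substitution is exact.
  set H : Eu n → ℝ≥0∞ := J.indicator fun z => G z ^ 2 with hHdef
  have hH : Measurable H := (hG.pow_const 2).indicator hJ
  have hHint : ∫⁻ z, H z = ∫⁻ z in J, G z ^ 2 := lintegral_indicator hJ _
  have h1 : ∀ x ∈ J, (∫⁻ y in B, ∫⁻ s in Set.Ioc (0 : ℝ) 1, G (y + s • (x - y))) ^ 2 ≤
      volume B * ∫⁻ y in B, ∫⁻ s in Set.Ioc (0 : ℝ) 1, H (y + s • (x - y)) := by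
    intro x hx
    refine (sq_lintegral_le _ ?_).trans ?_
    · exact (Measurable.lintegral_prod_right' (ν := volume.restrict (Set.Ioc (0 : ℝ) 1))
        (f := fun q : Eu n × ℝ => G (q.1 + q.2 • (x - q.1)))
        (hG.comp (by fun_prop))).aemeasurable
    · rw [Measure.restrict_apply_univ]
      refine mul_le_mul' le_rfl ?_
      refine setLIntegral_mono' hB fun y hy => ?_
      refine (sq_lintegral_le _ (hG.comp (by fun_prop)).aemeasurable).trans ?_
      simp only [Measure.restrict_apply_univ, Real.volume_Ioc, sub_zero, ENNReal.ofReal_one,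
        one_mul]
      refine setLIntegral_mono' measurableSet_Ioc fun s hs => ?_
      rw [hHdef, Set.indicator_of_mem (hseg x hx y hy s hs)]
      exact le_rfl
  -- For fixed `s`, the map `y + s • (x - y)` scales `x` by `s` and `y` by `1 - s`. Substituting in
  -- the variable with the factor at least `1/2` costs at most `2^n`; the other variable contributes
  -- only the volume of its domain.
  have h2 : ∀ s ∈ Set.Ioc (0 : ℝ) 1, ∫⁻ x in J, ∫⁻ y in B, H (y + s • (x - y)) ≤
      2 ^ n * volume J * ∫⁻ z in J, G z ^ 2 := by
    intro s hs
    have hvB : volume B ≤ volume J := measure_mono hBJ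
    rcases le_total (1 / 2) s with h | h
    · have hm : Measurable (Function.uncurry fun x y : Eu n => H (y + s • (x - y))) :=
        hH.comp (by fun_prop : Measurable fun q : Eu n × Eu n => q.2 + s • (q.1 - q.2))
      rw [lintegral_lintegral_swap hm.aemeasurable]
      calc ∫⁻ y in B, ∫⁻ x in J, H (y + s • (x - y))
          ≤ ∫⁻ y in B, 2 ^ n * ∫⁻ z in J, G z ^ 2 := by
            refine lintegral_mono fun y => ?_
            refine (setLIntegral_le_lintegral _ _).trans ?_
            rw [← hHint]
            have := lintegral_comp_smul_add_le hH h (y - s • y)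
            refine le_of_eq_of_le ?_ this
            congr 1; funext x; congr 1; module
        _ = volume B * (2 ^ n * ∫⁻ z in J, G z ^ 2) := by
            rw [lintegral_const, Measure.restrict_apply_univ, mul_comm]
        _ ≤ _ := by
            rw [mul_left_comm, ← mul_assoc]
            gcongr
    · calc ∫⁻ x in J, ∫⁻ y in B, H (y + s • (x - y))
          ≤ ∫⁻ x in J, 2 ^ n * ∫⁻ z in J, G z ^ 2 := by
            refine lintegral_mono fun x => ?_
            refine (setLIntegral_le_lintegral _ _).trans ?_
            rw [← hHint]
            have := lintegral_comp_smul_add_le hH (by linarith : 1 / 2 ≤ 1 - s) (s • x)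
            refine le_of_eq_of_le ?_ this
            congr 1; funext y; congr 1; module
        _ = _ := by
            rw [lintegral_const, Measure.restrict_apply_univ]
            ring
  calc ∫⁻ x in J, (∫⁻ y in B, ∫⁻ s in Set.Ioc (0 : ℝ) 1, G (y + s • (x - y))) ^ 2
      ≤ ∫⁻ x in J, volume B * ∫⁻ y in B, ∫⁻ s in Set.Ioc (0 : ℝ) 1, H (y + s • (x - y)) :=
        setLIntegral_mono' hJ h1
    _ = volume B * ∫⁻ x in J, ∫⁻ s in Set.Ioc (0 : ℝ) 1, ∫⁻ y in B, H (y + s • (x - y)) := by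
        rw [lintegral_const_mul' _ _ hBf]
        congr 2
        funext x
        exact lintegral_lintegral_swap (hH.comp (by fun_prop :
          Measurable fun q : Eu n × ℝ => q.1 + q.2 • (x - q.1))).aemeasurable
    _ = volume B * ∫⁻ s in Set.Ioc (0 : ℝ) 1, ∫⁻ x in J, ∫⁻ y in B, H (y + s • (x - y)) := by
        rw [lintegral_lintegral_swap]
        exact (Measurable.lintegral_prod_right' (ν := volume.restrict B)
          (f := fun q : (Eu n × ℝ) × Eu n => H (q.2 + q.1.2 • (q.1.1 - q.2)))
          (hH.comp (by fun_prop))).aemeasurable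
    _ ≤ volume B * ∫⁻ s in Set.Ioc (0 : ℝ) 1, 2 ^ n * volume J * ∫⁻ z in J, G z ^ 2 := by
        refine mul_le_mul' le_rfl ?_
        exact setLIntegral_mono' measurableSet_Ioc h2
    _ = _ := by
        rw [lintegral_const, Measure.restrict_apply_univ, Real.volume_Ioc, sub_zero,
          ENNReal.ofReal_one, mul_one]
        ring

/-! ### Taylor's formula for jets -/

/-- The multi-indices `α` with `|α| = k`. -/
def layer (n k : ℕ) : Finset (Fin n → ℕ) := {α ∈ multiIdx n k | ∑ i, α i = k}

theorem mem_layer {n k : ℕ} {α : Fin n → ℕ} : α ∈ layer n k ↔ ∑ i, α i = k := by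
  simp only [layer, Finset.mem_filter, mem_multiIdx, and_iff_right_iff_imp]
  exact fun h => h.le

theorem sum_multiIdx_succ_layer {n k : ℕ} (h : (Fin n → ℕ) → ℝ) :
    ∑ α ∈ multiIdx n (k + 1), h α = ∑ α ∈ multiIdx n k, h α + ∑ α ∈ layer n (k + 1), h α := by
  rw [← Finset.sum_filter_add_sum_filter_not (multiIdx n (k + 1)) (fun α => ∑ i, α i ≤ k)]
  congr 1 <;> refine Finset.sum_congr ?_ fun _ _ => rfl <;> ext α <;>
    simp only [Finset.mem_filter, mem_multiIdx, mem_layer] <;> omega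

theorem layer_zero (n : ℕ) : layer n 0 = {0} := by
  rw [layer, multiIdx_zero]
  ext α
  simp only [Finset.mem_filter, Finset.mem_singleton, and_iff_left_iff_imp]
  rintro rfl
  simp

/-- A family of continuous functions that behaves on `J` like the family of derivatives up to
order `m` of its member with index `0`. -/
structure IsJet {n : ℕ} (J : Set (Eu n)) (m : ℕ) (f : (Fin n → ℕ) → Eu n → ℝ) : Prop where
  cont : ∀ α, ∑ i, α i ≤ m → Continuous (f α)
  diff : ∀ α, ∑ i, α i < m → ∀ x ∈ J, DifferentiableAt ℝ (f α) x
  partialD_eq : ∀ α, ∑ i, α i < m → ∀ x ∈ J, ∀ i, partialD i (f α) x = f (α + eIdx i) x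

theorem fderiv_apply_eq_sum {n : ℕ} (f : Eu n → ℝ) (x v : Eu n) :
    fderiv ℝ f x v = ∑ i, v i * partialD i f x := by
  conv_lhs => rw [← (EuclideanSpace.basisFun (Fin n) ℝ).sum_repr v]
  simp [partialD]

/-- The Taylor polynomial of a jet about a point, at distance `v` from that point. -/
noncomputable def jetTaylor {n : ℕ} (k : ℕ) (f : (Fin n → ℕ) → Eu n → ℝ) (y v : Eu n) : ℝ :=
  ∑ α ∈ multiIdx n k, (1 / mfact α) * f α y * mono α v

/-- The integrand of the remainder in Taylor's formula. -/
noncomputable def jetRem {n : ℕ} (k : ℕ) (f : (Fin n → ℕ) → Eu n → ℝ) (y v : Eu n) (s : ℝ) : ℝ :=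
  ∑ α ∈ layer n k, ∑ i, (1 / mfact α) * mono (α + eIdx i) v * (1 - s) ^ k *
    f (α + eIdx i) (y + s • v)

/-- Write `|α| = ∑ i, α i` and absorb each `α i` into `α!` by the shift `α = β + eIdx i`. -/
theorem sum_card_mul_mono {n k : ℕ} (v : Eu n) (h : (Fin n → ℕ) → ℝ) :
    ∑ α ∈ multiIdx n (k + 1), ((∑ i, α i : ℕ) : ℝ) * (1 / mfact α * mono α v) * h α =
      ∑ β ∈ multiIdx n k, ∑ i, 1 / mfact β * mono (β + eIdx i) v * h (β + eIdx i) := by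
  push_cast
  simp only [Finset.sum_mul]
  rw [Finset.sum_comm, Finset.sum_comm (s := multiIdx n k)]
  refine Finset.sum_congr rfl fun i _ => ?_
  rw [sum_multiIdx_succ_eq i _ fun α hα => by simp [hα]]
  refine Finset.sum_congr rfl fun β _ => ?_
  rw [mfact_add_eIdx]
  have := (mfact_pos β).ne'
  simp only [Pi.add_apply, Pi.single_eq_same]
  push_cast
  field_simp

/-- The base point `y + s • v` moves while the evaluation point `y + v` stays fixed. Differentiating
`f α` raises the order by one and cancels the derivative of `(1 - s)^|α|` in the next layer
(`sum_card_mul_mono`), so only the top layer survives. -/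
theorem hasDerivAt_jetTaylor {n k : ℕ} {J : Set (Eu n)} {f : (Fin n → ℕ) → Eu n → ℝ}
    (hf : IsJet J (k + 1) f) {y v : Eu n} {s : ℝ} (hs : y + s • v ∈ J) :
    HasDerivAt (fun s : ℝ => jetTaylor k f (y + s • v) ((1 - s) • v)) (jetRem k f y v s) s := by
  have hterm : ∀ α ∈ multiIdx n k, HasDerivAt
      (fun s : ℝ => (1 / mfact α) * f α (y + s • v) * mono α ((1 - s) • v))
      (∑ i, (1 / mfact α) * mono (α + eIdx i) v * ((1 - s) ^ (∑ i, α i) *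
        f (α + eIdx i) (y + s • v)) -
        ((∑ i, α i : ℕ) : ℝ) * (1 / mfact α * mono α v) *
          ((1 - s) ^ (∑ i, α i - 1) * f α (y + s • v))) s := by
    intro α hα
    rw [mem_multiIdx] at hα
    have h1 : HasDerivAt (fun s : ℝ => f α (y + s • v))
        (∑ i, v i * f (α + eIdx i) (y + s • v)) s := by
      have hd := (hf.diff α (by omega) _ hs).hasFDerivAt
      have hl : HasDerivAt (fun s : ℝ => y + s • v) v s := by
        simpa using ((hasDerivAt_id s).smul_const v).const_add y
      refine (hd.comp_hasDerivAt s hl).congr_deriv ?_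
      rw [fderiv_apply_eq_sum]
      simp only [hf.partialD_eq α (by omega) _ hs]
    have h2 : HasDerivAt (fun s : ℝ => (1 - s) ^ (∑ i, α i))
        (((∑ i, α i : ℕ) : ℝ) * (1 - s) ^ (∑ i, α i - 1) * (-1)) s :=
      ((hasDerivAt_id s).const_sub 1).pow _
    simp only [mono_smul]
    have h3 := (h1.const_mul (1 / mfact α)).mul (h2.mul_const (mono α v))
    refine h3.congr_deriv ?_
    simp only [mono_add_eIdx]
    rw [Finset.mul_sum, Finset.sum_mul, sub_eq_add_neg]
    congr 1
    · exact Finset.sum_congr rfl fun i _ => by ring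
    · ring
  have hsum := HasDerivAt.fun_sum hterm
  refine hsum.congr_deriv ?_
  rw [Finset.sum_sub_distrib]
  have hl : jetRem k f y v s = ∑ α ∈ layer n k, ∑ i, (1 / mfact α) * mono (α + eIdx i) v *
      ((1 - s) ^ (∑ i, α i) * f (α + eIdx i) (y + s • v)) := by
    refine Finset.sum_congr rfl fun α hα => Finset.sum_congr rfl fun i _ => ?_
    rw [mem_layer.1 hα]
    ring
  rw [hl]
  cases k with
  | zero => simp [multiIdx_zero, layer_zero]
  | succ k =>
    rw [sum_multiIdx_succ_layer, sum_card_mul_mono]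
    simp only [sum_add_single, add_tsub_cancel_right]
    ring

theorem jetTaylor_zero_right {n k : ℕ} (f : (Fin n → ℕ) → Eu n → ℝ) (y : Eu n) :
    jetTaylor k f y 0 = f 0 y := by
  unfold jetTaylor
  rw [Finset.sum_eq_single 0]
  · simp [mono_zero, mfact]
  · intro α _ hα
    obtain ⟨i, hi⟩ := Function.ne_iff.1 hα
    have : mono α (0 : Eu n) = 0 :=
      Finset.prod_eq_zero (Finset.mem_univ i) (by simpa using hi)
    rw [this, mul_zero]
  · intro h
    simp [mem_multiIdx] at h

theorem continuous_jetRem {n k : ℕ} {J : Set (Eu n)} {f : (Fin n → ℕ) → Eu n → ℝ}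
    (hf : IsJet J (k + 1) f) (y v : Eu n) : Continuous (jetRem k f y v) := by
  unfold jetRem
  refine continuous_finsetSum _ fun α hα => continuous_finsetSum _ fun i _ => ?_
  have := hf.cont (α + eIdx i) (by rw [sum_add_single, mem_layer.1 hα])
  fun_prop

/-- Taylor's formula for jets, with integral remainder. -/
theorem jetTaylor_remainder {n k : ℕ} {J : Set (Eu n)} {f : (Fin n → ℕ) → Eu n → ℝ}
    (hf : IsJet J (k + 1) f) {x y : Eu n} (h : ∀ s ∈ Set.Icc (0 : ℝ) 1, y + s • (x - y) ∈ J) :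
    f 0 x - jetTaylor k f y (x - y) = ∫ s in Set.Ioc (0 : ℝ) 1, jetRem k f y (x - y) s := by
  have := intervalIntegral.integral_eq_sub_of_hasDerivAt
    (f := fun s : ℝ => jetTaylor k f (y + s • (x - y)) ((1 - s) • (x - y)))
    (f' := jetRem k f y (x - y)) (a := 0) (b := 1)
    (fun s hs => hasDerivAt_jetTaylor hf (h s (by rwa [Set.uIcc_of_le zero_le_one] at hs)))
    ((continuous_jetRem hf _ _).intervalIntegrable _ _)
  rw [intervalIntegral.integral_of_le zero_le_one] at this
  rw [this]
  simp [jetTaylor_zero_right]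

/-- The sum of the moduli of the members of order `k + 1` of a jet. -/
noncomputable def jetTop {n : ℕ} (k : ℕ) (f : (Fin n → ℕ) → Eu n → ℝ) (z : Eu n) : ℝ :=
  ∑ α ∈ layer n k, ∑ i, |f (α + eIdx i) z|

theorem jetTop_nonneg {n k : ℕ} (f : (Fin n → ℕ) → Eu n → ℝ) (z : Eu n) : 0 ≤ jetTop k f z :=
  Finset.sum_nonneg fun _ _ => Finset.sum_nonneg fun _ _ => abs_nonneg _

theorem abs_jetRem_le {n k : ℕ} (f : (Fin n → ℕ) → Eu n → ℝ) (y v : Eu n) {s D : ℝ}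
    (hs : s ∈ Set.Ioc (0 : ℝ) 1) (hv : ‖v‖ ≤ D) :
    |jetRem k f y v s| ≤ D ^ (k + 1) * jetTop k f (y + s • v) := by
  unfold jetRem jetTop
  refine (Finset.abs_sum_le_sum_abs _ _).trans ?_
  rw [Finset.mul_sum]
  refine Finset.sum_le_sum fun α hα => (Finset.abs_sum_le_sum_abs _ _).trans ?_
  rw [Finset.mul_sum]
  refine Finset.sum_le_sum fun i _ => ?_
  rw [abs_mul]
  refine mul_le_mul_of_nonneg_right ?_ (abs_nonneg _)
  rw [abs_mul, abs_mul]
  have h1 : |1 / mfact α| ≤ 1 := by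
    rw [abs_of_pos (by have := mfact_pos α; positivity), div_le_one (mfact_pos α)]
    exact one_le_mfact α
  have h2 : |mono (α + eIdx i) v| ≤ D ^ (k + 1) := by
    refine (abs_mono_le _ v).trans ?_
    rw [sum_add_single, mem_layer.1 hα]
    exact pow_le_pow_left₀ (norm_nonneg _) hv _
  have h3 : |(1 - s) ^ k| ≤ 1 := by
    rw [abs_pow]
    exact pow_le_one₀ (abs_nonneg _) (abs_le.2 ⟨by linarith [hs.2], by linarith [hs.1]⟩)
  have hD : 0 ≤ D := (norm_nonneg _).trans hv
  calc _ ≤ 1 * D ^ (k + 1) * 1 := by gcongr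
    _ = _ := by ring

theorem continuous_jetTop {n k : ℕ} {J : Set (Eu n)} {f : (Fin n → ℕ) → Eu n → ℝ}
    (hf : IsJet J (k + 1) f) : Continuous (jetTop k f) := by
  unfold jetTop
  refine continuous_finsetSum _ fun α hα => continuous_finsetSum _ fun i _ => ?_
  exact (hf.cont (α + eIdx i) (by rw [sum_add_single, mem_layer.1 hα])).abs

/-! ### Estimates for averaged Taylor polynomials -/

theorem IsStarBall.segment_mem {n : ℕ} {J : Set (Eu n)} {c : Eu n} {r : ℝ} (h : IsStarBall J c r)
    {x y : Eu n} (hx : x ∈ J) (hy : y ∈ Metric.ball c r) {s : ℝ} (hs : s ∈ Set.Icc (0 : ℝ) 1) :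
    y + s • (x - y) ∈ J := by
  have := h.star y hy hx (sub_nonneg.2 hs.2) hs.1 (by ring)
  convert this using 1
  module

/-- This exhibits `avgT` as a `φ`-average of ordinary Taylor polynomials, to which Taylor's formula
applies for each base point. -/
theorem avgT_eq_integral_jetTaylor {n k : ℕ} {c : Eu n} {r : ℝ} {φ : Eu n → ℝ}
    {g : (Fin n → ℕ) → Eu n → ℝ}
    (hg : ∀ α, ∑ i, α i ≤ k → IntegrableOn (fun y => g α y * φ y) (Metric.ball c r)) (x : Eu n) :
    avgT c r φ k g x = ∫ y in Metric.ball c r, φ y * jetTaylor k g y (x - y) := by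
  unfold avgT jetTaylor
  simp only [Finset.mul_sum]
  rw [integral_finsetSum]
  · refine Finset.sum_congr rfl fun α _ => ?_
    rw [← integral_const_mul]
    congr 1
    funext y
    ring
  · intro α hα
    refine ((integrableOn_mul_mono (hg α (mem_multiIdx.1 hα)) α x).const_mul
      (1 / mfact α)).congr (.of_forall fun y => ?_)
    ring

section Estimates

variable {n k : ℕ} {J : Set (Eu n)} {c : Eu n} {r M : ℝ} {φ : Eu n → ℝ}

/-- As `∫ φ = 1`, the value `f 0 x` can be taken inside the average, which leaves the Taylor
remainders along segments from the ball to `x`. -/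
theorem jet_sub_avgT_pointwise (hb : Bornology.IsBounded J)
    (hs : IsStarBall J c r) (hφ : Continuous φ) (hM : ∀ y, |φ y| ≤ M)
    (hφ1 : ∫ y in Metric.ball c r, φ y = 1) {f : (Fin n → ℕ) → Eu n → ℝ} (hf : IsJet J (k + 1) f)
    {x : Eu n} (hx : x ∈ J) :
    ‖f 0 x - avgT c r φ k f x‖ₑ ≤ ENNReal.ofReal (M * Metric.diam J ^ (k + 1)) *
      ∫⁻ y in Metric.ball c r, ∫⁻ s in Set.Ioc (0 : ℝ) 1, ‖jetTop k f (y + s • (x - y))‖ₑ := by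
  have hcont : ∀ {h : Eu n → ℝ}, Continuous h → IntegrableOn h (Metric.ball c r) := fun {h} hh =>
    (hh.continuousOn.integrableOn_compact (isCompact_closedBall c r)).mono_set
      Metric.ball_subset_closedBall
  have hfc : ∀ α, ∑ i, α i ≤ k → Continuous (f α) := fun α hα => hf.cont α (by omega)
  have hM0 : 0 ≤ M := (abs_nonneg _).trans (hM c)
  have hjt : Continuous fun y => jetTaylor k f y (x - y) := by
    unfold jetTaylor
    refine continuous_finsetSum _ fun α hα => ?_
    have h1 := hfc α (mem_multiIdx.1 hα)
    have h2 := (contDiff_mono α).continuous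
    fun_prop
  have h1 : f 0 x - avgT c r φ k f x =
      ∫ y in Metric.ball c r, φ y * (f 0 x - jetTaylor k f y (x - y)) := by
    rw [avgT_eq_integral_jetTaylor (fun α hα => hcont ((hfc α hα).mul hφ))]
    simp only [mul_sub]
    rw [integral_sub (hcont (by fun_prop)) (hcont (by fun_prop)), integral_mul_const, hφ1, one_mul]
  rw [h1]
  refine (enorm_integral_le_lintegral_enorm _).trans ?_
  rw [← lintegral_const_mul' _ _ ENNReal.ofReal_ne_top]
  refine setLIntegral_mono' measurableSet_ball fun y hy => ?_
  have hseg : ∀ s ∈ Set.Icc (0 : ℝ) 1, y + s • (x - y) ∈ J := fun s h => hs.segment_mem hx hy h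
  rw [enorm_mul, jetTaylor_remainder hf hseg, ENNReal.ofReal_mul hM0, mul_assoc]
  refine mul_le_mul' ?_ ?_
  · rw [← ofReal_norm]
    exact ENNReal.ofReal_le_ofReal (hM y)
  · refine (enorm_integral_le_lintegral_enorm _).trans ?_
    rw [← lintegral_const_mul' _ _ ENNReal.ofReal_ne_top]
    refine setLIntegral_mono' measurableSet_Ioc fun s hs' => ?_
    have hd : ‖x - y‖ ≤ Metric.diam J := by
      rw [← dist_eq_norm]
      exact Metric.dist_le_diam_of_mem hb hx (hs.ball_subset hy)
    rw [← ofReal_norm, ← ofReal_norm,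
      ← ENNReal.ofReal_mul (pow_nonneg Metric.diam_nonneg _)]
    refine ENNReal.ofReal_le_ofReal ?_
    rw [Real.norm_eq_abs, Real.norm_of_nonneg (jetTop_nonneg _ _)]
    exact abs_jetRem_le f y (x - y) hs' hd

theorem eLpNorm_jet_sub_avgT_le (hJ : IsOpen J) (hb : Bornology.IsBounded J)
    (hs : IsStarBall J c r) (hφ : Continuous φ) (hM : ∀ y, |φ y| ≤ M)
    (hφ1 : ∫ y in Metric.ball c r, φ y = 1) {f : (Fin n → ℕ) → Eu n → ℝ}
    (hf : IsJet J (k + 1) f) :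
    eLpNorm (fun x => f 0 x - avgT c r φ k f x) 2 (volume.restrict J) ≤
      ENNReal.ofReal (M * Metric.diam J ^ (k + 1)) *
        (2 ^ n * (volume (Metric.ball c r) * volume J)) ^ (1 / 2 : ℝ) *
          eLpNorm (jetTop k f) 2 (volume.restrict J) := by
  have hsq : ∀ a : ℝ≥0∞, (a ^ (1 / 2 : ℝ)) ^ 2 = a := fun a => by
    rw [← ENNReal.rpow_natCast, ← ENNReal.rpow_mul]
    norm_num
  rw [← ENNReal.pow_le_pow_left_iff two_ne_zero, mul_pow, mul_pow, hsq, eLpNorm_two_sq,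
    eLpNorm_two_sq]
  refine (setLIntegral_mono' hJ.measurableSet fun x hx => pow_le_pow_left'
    (jet_sub_avgT_pointwise hb hs hφ hM hφ1 hf hx) 2).trans ?_
  simp only [mul_pow]
  rw [lintegral_const_mul' _ _ (by simp), mul_assoc]
  refine mul_le_mul' le_rfl ?_
  exact lintegral_segment_sq_le hJ.measurableSet measurableSet_ball hs.ball_subset
    measure_ball_lt_top.ne (fun x hx y hy s h => hs.segment_mem hx hy ⟨h.1.le, h.2⟩)
    (G := fun z => ‖jetTop k f z‖ₑ) (continuous_jetTop hf).measurable.enorm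

/-- A crude `L²` stability bound. The size of `K` is irrelevant: it only serves to pass to the limit
from smooth jets and does not enter the final constant. -/
theorem exists_eLpNorm_avgT_le (hb : Bornology.IsBounded J) (hJ : MeasurableSet J)
    (hBJ : Metric.ball c r ⊆ J) (hM : ∀ y, |φ y| ≤ M) :
    ∃ K : ℝ≥0∞, K ≠ ⊤ ∧ ∀ g : (Fin n → ℕ) → Eu n → ℝ,
      (∀ α ∈ multiIdx n k, AEStronglyMeasurable (g α) (volume.restrict J)) →
      eLpNorm (avgT c r φ k g) 2 (volume.restrict J) ≤
        ∑ α ∈ multiIdx n k, K * eLpNorm (g α) 2 (volume.restrict J) := by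
  have hM0 : 0 ≤ M := (abs_nonneg _).trans (hM c)
  have hJf : volume J ≠ ⊤ := hb.measure_lt_top.ne
  set D := Metric.diam J
  have hD : 0 ≤ D := Metric.diam_nonneg
  set L : ℝ≥0∞ := ENNReal.ofReal (M * (1 + D) ^ k) with hL
  refine ⟨L * volume J ^ (1 / 2 : ℝ) * volume J ^ (1 / 2 : ℝ), ?_, fun g hg => ?_⟩
  · have : volume J ^ (1 / 2 : ℝ) ≠ ⊤ := ENNReal.rpow_ne_top_of_nonneg (by norm_num) hJf
    exact ENNReal.mul_ne_top (ENNReal.mul_ne_top ENNReal.ofReal_ne_top this) this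
  have hpt : ∀ x ∈ J, ‖avgT c r φ k g x‖ₑ ≤ ∑ α ∈ multiIdx n k, L * ∫⁻ y in J, ‖g α y‖ₑ := by
    intro x hx
    refine (enorm_sum_le _ _).trans (Finset.sum_le_sum fun α hα => ?_)
    have h1 : ‖1 / mfact α‖ₑ ≤ 1 := by
      rw [← ofReal_norm, ← ENNReal.ofReal_one]
      refine ENNReal.ofReal_le_ofReal ?_
      rw [Real.norm_of_nonneg (by have := mfact_pos α; positivity), div_le_one (mfact_pos α)]
      exact one_le_mfact α
    rw [enorm_mul]
    refine (mul_le_mul' h1 (enorm_integral_le_lintegral_enorm _)).trans ?_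
    rw [one_mul, ← lintegral_const_mul' _ _ ENNReal.ofReal_ne_top]
    refine (setLIntegral_mono' (g := fun y => L * ‖g α y‖ₑ) measurableSet_ball
      fun y hy => ?_).trans (lintegral_mono_set hBJ)
    have hd : ‖x - y‖ ≤ D := by
      rw [← dist_eq_norm]
      exact Metric.dist_le_diam_of_mem hb hx (hBJ hy)
    rw [mul_assoc, enorm_mul, mul_comm]
    refine mul_le_mul' ?_ le_rfl
    rw [← ofReal_norm, hL]
    refine ENNReal.ofReal_le_ofReal ?_
    rw [Real.norm_eq_abs, abs_mul]
    refine mul_le_mul (hM y) ?_ (abs_nonneg _) hM0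
    calc |mono α (x - y)| ≤ ‖x - y‖ ^ (∑ i, α i) := abs_mono_le _ _
      _ ≤ (1 + D) ^ (∑ i, α i) := pow_le_pow_left₀ (norm_nonneg _) (by linarith) _
      _ ≤ (1 + D) ^ k := pow_le_pow_right₀ (by linarith) (mem_multiIdx.1 hα)
  have hholder : ∀ α ∈ multiIdx n k, ∫⁻ y in J, ‖g α y‖ₑ ≤
      volume J ^ (1 / 2 : ℝ) * eLpNorm (g α) 2 (volume.restrict J) := by
    intro α hα
    rw [← ENNReal.pow_le_pow_left_iff two_ne_zero, mul_pow, eLpNorm_two_sq,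
      ← ENNReal.rpow_natCast (volume J ^ (1 / 2 : ℝ)), ← ENNReal.rpow_mul]
    have := sq_lintegral_le (volume.restrict J) (hg α hα).enorm
    rw [Measure.restrict_apply_univ] at this
    simpa using this
  refine (eLpNorm_le_of_ae_enorm_bound ((ae_restrict_iff' hJ).2 (.of_forall hpt))).trans ?_
  rw [Measure.restrict_apply_univ, smul_eq_mul, Finset.sum_mul]
  refine Finset.sum_le_sum fun α hα => ?_
  calc _ ≤ L * (volume J ^ (1 / 2 : ℝ) * eLpNorm (g α) 2 (volume.restrict J)) *
        volume J ^ (1 / 2 : ℝ) := by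
        have := hholder α hα
        simp only [ENNReal.toReal_ofNat, one_div]
        simp only [one_div] at this
        gcongr
    _ = _ := by ring

end Estimates

/-! ### Approximation by smooth jets -/

/-- Dilation about `c` by the factor `t`, followed by mollification with the bump function `b`. -/
noncomputable def dilMoll {n : ℕ} (J : Set (Eu n)) (c : Eu n) (b : ContDiffBump (0 : Eu n)) (t : ℝ)
    (g : Eu n → ℝ) (x : Eu n) : ℝ :=
  ∫ y in J, g y * b.normed volume (c + t • (x - c) - y)

section DilMoll

variable {n : ℕ} {J : Set (Eu n)} {c : Eu n} {b : ContDiffBump (0 : Eu n)} {t : ℝ}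
  {g : Eu n → ℝ}

theorem contDiff_dilMoll_kernel :
    ContDiff ℝ 1 (Function.uncurry fun x y : Eu n => b.normed volume (c + t • (x - c) - y)) :=
  (b.contDiff_normed (n := 1)).comp (by fun_prop)

theorem differentiable_dilMoll (hb : Bornology.IsBounded J) (hJ : MeasurableSet J)
    (hg : IntegrableOn g J) : Differentiable ℝ (dilMoll J c b t g) := fun x =>
  (hasFDerivAt_setIntegral_mul hb hJ hg contDiff_dilMoll_kernel x).differentiableAt

theorem isTest_dilMoll_kernel {P : Eu n} (hP : Metric.closedBall P b.rOut ⊆ J) :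
    IsTest J fun y => b.normed volume (P - y) := by
  have hs : tsupport (fun y => b.normed volume (P - y)) ⊆ Metric.closedBall P b.rOut := by
    refine closure_minimal (fun y hy => ?_) Metric.isClosed_closedBall
    have : P - y ∈ Metric.ball (0 : Eu n) b.rOut := by
      rw [← b.support_normed_eq (μ := volume)]
      exact hy
    rw [mem_ball_zero_iff] at this
    rw [Metric.mem_closedBall, dist_comm, dist_eq_norm]
    exact this.le
  exact ⟨(b.contDiff_normed (n := ⊤)).comp (by fun_prop),
    (isCompact_closedBall P b.rOut).of_isClosed_subset (isClosed_tsupport _) hs, hs.trans hP⟩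

/-- The `x`-derivative of the kernel is `-t` times its `y`-derivative. Since the kernel is a test
function on `J`, the weak derivative can take over. -/
theorem partialD_dilMoll (hb : Bornology.IsBounded J) (hJ : MeasurableSet J) {u w : L2 J}
    (hu : IntegrableOn u J) {i : Fin n} (hw : IsWeakDeriv J (eIdx i) u w) {x : Eu n}
    (hP : Metric.closedBall (c + t • (x - c)) b.rOut ⊆ J) :
    partialD i (dilMoll J c b t u) x = t * dilMoll J c b t w x := by
  have hη : ∀ z, DifferentiableAt ℝ (b.normed volume) z := fun z =>
    ((b.contDiff_normed (n := 1)).differentiable (by simp)).differentiableAt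
  have hT := isTest_dilMoll_kernel hP
  have h1 := hw _ hT
  rw [mderiv_single hT.smooth, sum_single_one, pow_one] at h1
  have hx : ∀ y, partialD i (fun x => b.normed volume (c + t • (x - c) - y)) x =
      -t * partialD i (fun y => b.normed volume (c + t • (x - c) - y)) y := by
    intro y
    have e1 : HasFDerivAt (fun x : Eu n => c + t • (x - c) - y)
        (t • ContinuousLinearMap.id ℝ (Eu n)) x :=
      ((((hasFDerivAt_id x).sub_const c).const_smul t).const_add c).sub_const y
    have e2 : HasFDerivAt (fun y : Eu n => c + t • (x - c) - y)
        (-ContinuousLinearMap.id ℝ (Eu n)) y := (hasFDerivAt_id y).const_sub _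
    unfold partialD
    have f1 := ((hη _).hasFDerivAt.comp x e1).fderiv
    have f2 := ((hη _).hasFDerivAt.comp y e2).fderiv
    simp only [Function.comp_def] at f1 f2
    rw [f1, f2]
    simp
  have h2 := partialD_setIntegral_mul hb hJ hu
    (contDiff_dilMoll_kernel (c := c) (b := b) (t := t)) i x
  refine h2.trans ?_
  simp only [hx, mul_left_comm _ (-t)]
  rw [integral_const_mul, h1]
  unfold dilMoll
  ring

theorem setLIntegral_kernel_le (P : Eu n) :
    ∫⁻ y in J, ENNReal.ofReal (b.normed volume (P - y)) ≤ 1 := by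
  refine (setLIntegral_le_lintegral _ _).trans ?_
  rw [lintegral_sub_left_eq_self (μ := volume) fun y => ENNReal.ofReal (b.normed volume y),
    ← ofReal_integral_eq_lintegral_ofReal b.integrable_normed (.of_forall b.nonneg_normed),
    b.integral_normed, ENNReal.ofReal_one]

/-- Cauchy-Schwarz for the kernel as a density of mass at most one, then Tonelli; undoing the
dilation costs `t^(-n) ≤ 2^n`. The bound is uniform in `b` and `t`, as the density argument
requires. -/
theorem eLpNorm_dilMoll_le (ht : 1 / 2 ≤ t) (hg : AEMeasurable g (volume.restrict J)) :
    eLpNorm (dilMoll J c b t g) 2 volume ≤ 2 ^ n * eLpNorm g 2 (volume.restrict J) := by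
  rw [← ENNReal.pow_le_pow_left_iff two_ne_zero, mul_pow, eLpNorm_two_sq, eLpNorm_two_sq]
  set η : Eu n → ℝ≥0∞ := fun z => ENNReal.ofReal (b.normed volume z) with hηdef
  have hη : Measurable η := b.continuous_normed.measurable.ennreal_ofReal
  have hpt : ∀ x, ‖dilMoll J c b t g x‖ₑ ^ 2 ≤
      ∫⁻ y in J, ‖g y‖ₑ ^ 2 * η (c + t • (x - c) - y) := by
    intro x
    set P := c + t • (x - c)
    have hηP : Measurable fun y => η (P - y) := hη.comp (by fun_prop)
    have h1 : ‖dilMoll J c b t g x‖ₑ ≤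
        ∫⁻ y, ‖g y‖ₑ ∂((volume.restrict J).withDensity fun y => η (P - y)) := by
      rw [lintegral_withDensity_eq_lintegral_mul₀ hηP.aemeasurable hg.enorm]
      refine (enorm_integral_le_lintegral_enorm _).trans (lintegral_mono fun y => ?_)
      rw [enorm_mul, mul_comm, Pi.mul_apply, hηdef, Real.enorm_of_nonneg (b.nonneg_normed _)]
    refine (pow_le_pow_left' h1 2).trans ?_
    have hac : (volume.restrict J).withDensity (fun y => η (P - y)) ≪ volume.restrict J :=
      withDensity_absolutelyContinuous _ _
    refine (sq_lintegral_le _ (hg.mono_ac hac).enorm).trans ?_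
    rw [withDensity_apply _ MeasurableSet.univ, Measure.restrict_univ,
      lintegral_withDensity_eq_lintegral_mul₀ hηP.aemeasurable (hg.enorm.pow_const 2)]
    refine (mul_le_mul' (setLIntegral_kernel_le P) le_rfl).trans ?_
    rw [one_mul]
    exact lintegral_mono fun y => (mul_comm (η (P - y)) (‖g y‖ₑ ^ 2)).le
  refine (lintegral_mono hpt).trans ?_
  rw [lintegral_lintegral_swap]
  · have h2 : ∀ y, ∫⁻ x, ‖g y‖ₑ ^ 2 * η (c + t • (x - c) - y) ≤ ‖g y‖ₑ ^ 2 * 2 ^ n := by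
      intro y
      rw [lintegral_const_mul' _ _ (by simp)]
      refine mul_le_mul' le_rfl ?_
      have h3 := lintegral_comp_smul_add_le hη ht (c - t • c - y)
      have h4 : ∫⁻ z, η z = 1 := by
        rw [hηdef, ← ofReal_integral_eq_lintegral_ofReal b.integrable_normed
          (.of_forall b.nonneg_normed), b.integral_normed, ENNReal.ofReal_one]
      rw [h4, mul_one] at h3
      refine le_of_eq_of_le ?_ h3
      congr 1; funext x; congr 1; module
    refine (lintegral_mono h2).trans ?_
    rw [lintegral_mul_const' _ _ (by simp), mul_comm]
    refine mul_le_mul' ?_ le_rfl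
    exact le_self_pow₀ (one_le_pow₀ (by norm_num)) two_ne_zero
  · have m1 : AEMeasurable (fun q : Eu n × Eu n => ‖g q.2‖ₑ ^ 2)
        (volume.prod (volume.restrict J)) := (hg.enorm.pow_const 2).comp_snd
    have m2 : Measurable fun q : Eu n × Eu n => η (c + t • (q.1 - c) - q.2) :=
      hη.comp (by fun_prop)
    exact m1.mul m2.aemeasurable

theorem abs_dilMoll_sub_le {h : Eu n → ℝ} (hc : Continuous h) {x : Eu n}
    {ε : ℝ} (hP : Metric.closedBall (c + t • (x - c)) b.rOut ⊆ J)
    (hε : ∀ y ∈ Metric.closedBall (c + t • (x - c)) b.rOut, |h y - h x| ≤ ε) :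
    |dilMoll J c b t h x - h x| ≤ ε := by
  set P := c + t • (x - c) with hPdef
  have hT := isTest_dilMoll_kernel hP
  have hone : ∫ y in J, b.normed volume (P - y) = 1 := by
    rw [setIntegral_eq_integral_of_forall_compl_eq_zero fun y hy => hT.eq_zero hy,
      integral_sub_left_eq_self (fun y => b.normed volume y) volume, b.integral_normed]
  have hint : ∀ {f : Eu n → ℝ}, Continuous f →
      Integrable (fun y => f y * b.normed volume (P - y)) (volume.restrict J) := fun hf =>
    ((hf.mul hT.smooth.continuous).integrable_of_hasCompactSupport
      hT.compact.mul_left).integrableOn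
  have hsub : dilMoll J c b t h x - h x =
      ∫ y in J, (h y - h x) * b.normed volume (P - y) := by
    simp only [sub_mul]
    rw [integral_sub (hint hc) (hint continuous_const), integral_const_mul, hone, mul_one]
    rfl
  rw [hsub, ← Real.norm_eq_abs]
  calc ‖∫ y in J, (h y - h x) * b.normed volume (P - y)‖
      ≤ ∫ y in J, ε * b.normed volume (P - y) := by
        refine norm_integral_le_of_norm_le (hint continuous_const) (.of_forall fun y => ?_)
        rw [norm_mul, Real.norm_of_nonneg (b.nonneg_normed _)]
        by_cases hy : y ∈ Metric.closedBall P b.rOut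
        · exact mul_le_mul_of_nonneg_right (hε y hy) (b.nonneg_normed _)
        · have h0 : b.normed volume (P - y) = 0 := by
            by_contra h0
            have : P - y ∈ Metric.ball (0 : Eu n) b.rOut := by
              rw [← b.support_normed_eq (μ := volume)]
              exact h0
            rw [mem_ball_zero_iff] at this
            exact hy (by rw [Metric.mem_closedBall, dist_comm, dist_eq_norm]; exact this.le)
          rw [h0, mul_zero, mul_zero]
    _ = ε := by rw [integral_const_mul, hone, mul_one]

end DilMoll

/-- A point `z` of the small ball equals `(1 - t) • y + t • x` with `y` within `r / 2` of `c`, so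
star-shapedness with respect to `y` applies. This fixes the mollification radius used below. -/
theorem IsStarBall.closedBall_subset {n : ℕ} {J : Set (Eu n)} {c : Eu n} {r : ℝ}
    (h : IsStarBall J c r) {t : ℝ} (ht0 : 0 ≤ t) (ht : t < 1) {x : Eu n} (hx : x ∈ J) :
    Metric.closedBall (c + t • (x - c)) ((1 - t) * (r / 2)) ⊆ J := by
  intro z hz
  have h1 : 0 < 1 - t := by linarith
  rw [Metric.mem_closedBall, dist_eq_norm] at hz
  set y := c + (1 - t)⁻¹ • (z - (c + t • (x - c))) with hy
  have hyB : y ∈ Metric.ball c r := by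
    rw [Metric.mem_ball, dist_eq_norm, hy, add_sub_cancel_left, norm_smul, norm_inv,
      Real.norm_of_nonneg h1.le, inv_mul_lt_iff₀ h1]
    have := h.pos
    nlinarith
  have := h.star y hyB hx h1.le ht0 (by ring)
  convert this using 1
  rw [hy, smul_add, smul_inv_smul₀ h1.ne']
  module

/-! ### Convergence of dilated mollifications as the dilation factor tends to one -/

section Convergence

variable {n : ℕ} {J : Set (Eu n)} {c : Eu n} {r : ℝ} {g : Eu n → ℝ}

theorem eventually_eLpNorm_dilMoll_sub_le_of_continuous (hJ : IsOpen J)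
    (hb : Bornology.IsBounded J) (hs : IsStarBall J c r) {h : Eu n → ℝ} (hc : Continuous h)
    (hcs : HasCompactSupport h) {ε : ℝ≥0∞} (hε : ε ≠ 0) :
    ∀ᶠ t in 𝓝[<] (1 : ℝ), ∀ b : ContDiffBump (0 : Eu n), b.rOut = (1 - t) * (r / 2) →
      eLpNorm (fun x => dilMoll J c b t h x - h x) 2 (volume.restrict J) ≤ ε := by
  have hV : volume J ^ (2 : ℝ≥0∞).toReal⁻¹ ≠ ⊤ :=
    ENNReal.rpow_ne_top_of_nonneg (by positivity) hb.measure_lt_top.ne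
  obtain ⟨e, he, hlt⟩ := ENNReal.exists_nnreal_pos_mul_lt hV hε
  obtain ⟨d, hd, hu⟩ := Metric.uniformContinuous_iff.1
    (hcs.uniformContinuous_of_continuous hc) e (by exact_mod_cast he)
  -- Every point entering the average at `x` is within `(1 - t) * (diam J + r)` of `x`: the dilation
  -- displaces `x` by at most `(1 - t) * diam J`, and the mollifier adds at most `(1 - t) * (r /
  -- 2)`.
  have hlim : Filter.Tendsto (fun t : ℝ => (1 - t) * (Metric.diam J + r)) (𝓝[<] 1) (𝓝 0) := by
    have : Continuous fun t : ℝ => (1 - t) * (Metric.diam J + r) := by fun_prop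
    simpa using (this.tendsto 1).mono_left nhdsWithin_le_nhds
  have h0 : ∀ᶠ t in 𝓝[<] (1 : ℝ), 0 < t :=
    nhdsWithin_le_nhds (lt_mem_nhds (by norm_num : (0 : ℝ) < 1))
  filter_upwards [hlim.eventually (gt_mem_nhds hd), h0, self_mem_nhdsWithin] with t ht ht0 ht1 b hbt
  rw [Set.mem_Iio] at ht1
  have hpt : ∀ x ∈ J, ‖dilMoll J c b t h x - h x‖ₑ ≤ (e : ℝ≥0∞) := by
    intro x hx
    have := abs_dilMoll_sub_le (b := b) (t := t) hc (x := x) (ε := e)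
      (hbt ▸ hs.closedBall_subset ht0.le ht1 hx) ?_
    · rw [← ofReal_norm, Real.norm_eq_abs]
      exact (ENNReal.ofReal_le_ofReal this).trans (by simp)
    · intro y hy
      rw [← Real.dist_eq]
      refine (hu ?_).le
      rw [Metric.mem_closedBall, hbt] at hy
      refine lt_of_le_of_lt ?_ ht
      have hxc : dist x c ≤ Metric.diam J :=
        Metric.dist_le_diam_of_mem hb hx (hs.ball_subset (Metric.mem_ball_self hs.pos))
      have hPx : dist (c + t • (x - c)) x = (1 - t) * dist x c := by
        rw [dist_comm, dist_eq_norm, dist_eq_norm,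
          show x - (c + t • (x - c)) = (1 - t) • (x - c) by module, norm_smul,
          Real.norm_of_nonneg (by linarith)]
      have := dist_triangle y (c + t • (x - c)) x
      have := hs.pos
      nlinarith
  refine (eLpNorm_le_of_ae_enorm_bound
    ((ae_restrict_iff' hJ.measurableSet).2 (.of_forall hpt))).trans ?_
  rw [Measure.restrict_apply_univ, smul_eq_mul]
  exact hlt.le

theorem eventually_eLpNorm_dilMoll_sub_le (hJ : IsOpen J)
    (hb : Bornology.IsBounded J) (hs : IsStarBall J c r) (hg : MemLp g 2 (volume.restrict J))
    {ε : ℝ≥0∞} (hε : ε ≠ 0) :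
    ∀ᶠ t in 𝓝[<] (1 : ℝ), ∀ b : ContDiffBump (0 : Eu n), b.rOut = (1 - t) * (r / 2) →
      eLpNorm (fun x => dilMoll J c b t g x - g x) 2 (volume.restrict J) ≤ ε := by
  have hfin : IsFiniteMeasure (volume.restrict J) := ⟨by simpa using hb.measure_lt_top⟩
  have hε3 : ε / 3 ≠ 0 := by simpa using hε
  obtain ⟨e, he, hlt⟩ := ENNReal.exists_nnreal_pos_mul_lt (a := 2 ^ n) (by simp) hε3
  obtain ⟨h, hcs, hgh, hc, hh⟩ := hg.exists_hasCompactSupport_eLpNorm_sub_le (by norm_num)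
    (ε := e) (by exact_mod_cast he.ne')
  have h0 : ∀ᶠ t in 𝓝[<] (1 : ℝ), 1 / 2 < t :=
    nhdsWithin_le_nhds (lt_mem_nhds (by norm_num))
  filter_upwards [eventually_eLpNorm_dilMoll_sub_le_of_continuous hJ hb hs hc hcs hε3, h0]
    with t ht ht0 b hbt
  have hgi : IntegrableOn g J := hg.integrable (by norm_num)
  have hhi : IntegrableOn h J := hh.integrable (by norm_num)
  -- The three-term argument with a continuous `h` close to `g`; the term in `g - h` is controlled
  -- by the uniform bound.
  have hlin : (fun x => dilMoll J c b t g x - g x) = dilMoll J c b t (g - h) +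
      ((fun x => dilMoll J c b t h x - h x) + (h - g)) := by
    funext x
    have : dilMoll J c b t (g - h) x = dilMoll J c b t g x - dilMoll J c b t h x := by
      have hk : Continuous fun y => b.normed volume (c + t • (x - c) - y) :=
        b.continuous_normed.comp (by fun_prop)
      unfold dilMoll
      rw [← integral_sub (integrableOn_mul_of_continuous hb hJ.measurableSet hgi hk)
        (integrableOn_mul_of_continuous hb hJ.measurableSet hhi hk)]
      simp only [Pi.sub_apply, sub_mul]
    simp only [Pi.add_apply, Pi.sub_apply, this]
    ring
  have hm1 : AEStronglyMeasurable (dilMoll J c b t (g - h)) (volume.restrict J) :=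
    (differentiable_dilMoll hb hJ.measurableSet (hgi.sub hhi)).continuous.aestronglyMeasurable
  have hm2 : AEStronglyMeasurable (fun x => dilMoll J c b t h x - h x) (volume.restrict J) :=
    ((differentiable_dilMoll hb hJ.measurableSet hhi).continuous.sub hc).aestronglyMeasurable
  have hm3 : AEStronglyMeasurable (h - g) (volume.restrict J) := hh.1.sub hg.1
  have hle : (e : ℝ≥0∞) * 2 ^ n ≤ ε / 3 := hlt.le
  have hle' : (e : ℝ≥0∞) ≤ ε / 3 :=
    (le_mul_of_one_le_right zero_le (one_le_pow₀ (by norm_num))).trans hle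
  rw [hlin]
  refine (eLpNorm_add_le hm1 (hm2.add hm3) (by norm_num)).trans ?_
  have h1 : eLpNorm (dilMoll J c b t (g - h)) 2 (volume.restrict J) ≤ ε / 3 := by
    refine (eLpNorm_mono_measure _ Measure.restrict_le_self).trans
      ((eLpNorm_dilMoll_le ht0.le (hg.1.sub hh.1).aemeasurable).trans ?_)
    rw [mul_comm]
    exact (mul_le_mul' hgh le_rfl).trans hle
  have h2 := (eLpNorm_add_le hm2 hm3 (p := 2) (by norm_num)).trans
    (add_le_add (ht b hbt) (((eLpNorm_sub_comm h g 2 _).trans_le hgh).trans hle'))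
  refine (add_le_add h1 h2).trans ?_
  rw [← add_assoc, ENNReal.add_thirds]

/-- The factor `t ^ m` is the one that `m` derivatives of a dilated function acquire; it tends to
one. -/
theorem eventually_eLpNorm_pow_mul_dilMoll_sub_le (hJ : IsOpen J)
    (hb : Bornology.IsBounded J) (hs : IsStarBall J c r) (hg : MemLp g 2 (volume.restrict J))
    (m : ℕ) {ε : ℝ≥0∞} (hε : ε ≠ 0) :
    ∀ᶠ t in 𝓝[<] (1 : ℝ), ∀ b : ContDiffBump (0 : Eu n), b.rOut = (1 - t) * (r / 2) →
      eLpNorm (fun x => t ^ m * dilMoll J c b t g x - g x) 2 (volume.restrict J) ≤ ε := by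
  have hfin : IsFiniteMeasure (volume.restrict J) := ⟨by simpa using hb.measure_lt_top⟩
  have hε2 : ε / 2 ≠ 0 := by simpa using hε
  have hlim : Filter.Tendsto (fun t : ℝ => ENNReal.ofReal |t ^ m - 1| *
      eLpNorm g 2 (volume.restrict J)) (𝓝[<] 1) (𝓝 0) := by
    have h1 : Continuous fun t : ℝ => ENNReal.ofReal |t ^ m - 1| :=
      ENNReal.continuous_ofReal.comp (by fun_prop)
    have h2 := ENNReal.Tendsto.mul_const (b := eLpNorm g 2 (volume.restrict J))
      ((h1.tendsto 1).mono_left (nhdsWithin_le_nhds (s := Set.Iio 1))) (.inr hg.2.ne)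
    simpa using h2
  have h0 : ∀ᶠ t in 𝓝[<] (1 : ℝ), 0 < t :=
    nhdsWithin_le_nhds (lt_mem_nhds (by norm_num))
  filter_upwards [eventually_eLpNorm_dilMoll_sub_le hJ hb hs hg hε2,
    hlim.eventually (gt_mem_nhds (pos_iff_ne_zero.2 hε2)), h0, self_mem_nhdsWithin]
    with t ht htm ht0 ht1 b hbt
  rw [Set.mem_Iio] at ht1
  have hgi : IntegrableOn g J := hg.integrable (by norm_num)
  have hm1 : AEStronglyMeasurable (fun x => dilMoll J c b t g x - g x) (volume.restrict J) :=
    (differentiable_dilMoll hb hJ.measurableSet hgi).continuous.aestronglyMeasurable.sub hg.1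
  have hlin : (fun x => t ^ m * dilMoll J c b t g x - g x) =
      (t ^ m) • (fun x => dilMoll J c b t g x - g x) + (t ^ m - 1) • g := by
    funext x
    simp only [Pi.add_apply, Pi.smul_apply, smul_eq_mul]
    ring
  rw [hlin]
  refine (eLpNorm_add_le (hm1.const_smul _) (hg.1.const_smul _) (by norm_num)).trans ?_
  rw [eLpNorm_const_smul, eLpNorm_const_smul, ← ofReal_norm, ← ofReal_norm (t ^ m - 1),
    Real.norm_eq_abs (t ^ m - 1), ← ENNReal.add_halves ε]
  refine add_le_add ?_ htm.le
  have hone : ENNReal.ofReal ‖t ^ m‖ ≤ 1 := by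
    rw [← ENNReal.ofReal_one]
    refine ENNReal.ofReal_le_ofReal ?_
    rw [Real.norm_of_nonneg (by positivity)]
    exact pow_le_one₀ ht0.le ht1.le
  exact (mul_le_mul' hone (ht b hbt)).trans (one_mul _).le

/-- The weak derivatives of a Sobolev function are limits of smooth jets. -/
theorem exists_isJet_eLpNorm_sub_le {k : ℕ} (hJ : IsOpen J) (hb : Bornology.IsBounded J)
    (hs : IsStarBall J c r) {u : L2 J} (hu : u ∈ sobolev k J) {ε : ℝ≥0∞} (hε : ε ≠ 0) :
    ∃ f, IsJet J k f ∧ ∀ α ∈ multiIdx n k,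
      eLpNorm (fun x => f α x - weakD J α u x) 2 (volume.restrict J) ≤ ε := by
  have hfin : IsFiniteMeasure (volume.restrict J) := ⟨by simpa using hb.measure_lt_top⟩
  have h0 : ∀ᶠ t in 𝓝[<] (1 : ℝ), 0 < t :=
    nhdsWithin_le_nhds (lt_mem_nhds (by norm_num))
  -- Only finitely many `α` occur, so one `t` serves them all.
  have hall : ∀ᶠ t in 𝓝[<] (1 : ℝ), ∀ α ∈ multiIdx n k, ∀ b : ContDiffBump (0 : Eu n),
      b.rOut = (1 - t) * (r / 2) → eLpNorm (fun x => t ^ (∑ i, α i) *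
        dilMoll J c b t (weakD J α u) x - weakD J α u x) 2 (volume.restrict J) ≤ ε :=
    (Finset.eventually_all _).2 fun α _ =>
      eventually_eLpNorm_pow_mul_dilMoll_sub_le hJ hb hs (Lp.memLp _) _ hε
  obtain ⟨t, ht, ht0, ht1⟩ := (hall.and (h0.and self_mem_nhdsWithin)).exists
  have hδ : 0 < (1 - t) * (r / 2) := mul_pos (by linarith) (by linarith [hs.pos])
  let b : ContDiffBump (0 : Eu n) := ⟨(1 - t) * (r / 2) / 2, (1 - t) * (r / 2), by linarith,
    by linarith⟩
  have hint : ∀ w : L2 J, IntegrableOn w J := fun w => (Lp.memLp w).integrable (by norm_num)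
  -- The power of `t` makes the family consistent: by the chain rule each `∂ᵢ` contributes one
  -- factor `t`.
  refine ⟨fun α x => t ^ (∑ i, α i) * dilMoll J c b t (weakD J α u) x, ⟨?_, ?_, ?_⟩,
    fun α hα => ht α hα b rfl⟩
  · exact fun α _ => continuous_const.mul
      (differentiable_dilMoll hb hJ.measurableSet (hint _)).continuous
  · exact fun α _ x _ => ((differentiable_dilMoll hb hJ.measurableSet (hint _)).const_mul _) x
  · intro α hα x hx i
    have hw : IsWeakDeriv J (eIdx i) (weakD J α u) (weakD J (α + eIdx i) u) := by
      rw [add_comm]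
      exact isWeakDeriv_weakD_weakD hu (by rw [sum_single_one]; omega)
    have hp := partialD_dilMoll (b := b) hb hJ.measurableSet (hint _) hw
      (hs.closedBall_subset ht0.le ht1 hx)
    unfold partialD at hp ⊢
    rw [fderiv_const_mul (differentiable_dilMoll hb hJ.measurableSet (hint _) x),
      smul_apply, hp, sum_add_single, smul_eq_mul]
    ring

end Convergence

/-! ### The Bramble–Hilbert estimate -/

section BrambleHilbert

variable {n k : ℕ} {J : Set (Eu n)} {c : Eu n} {r M : ℝ} {φ : Eu n → ℝ}

theorem integrableOn_L2_mul (hb : Bornology.IsBounded J) (hBJ : Metric.ball c r ⊆ J)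
    (hφ : Continuous φ) (w : L2 J) :
    IntegrableOn (fun y => w y * φ y) (Metric.ball c r) := by
  have hfin : IsFiniteMeasure (volume.restrict J) := ⟨by simpa using hb.measure_lt_top⟩
  have hw : IntegrableOn w J := (Lp.memLp w).integrable (by norm_num)
  exact integrableOn_mul_of_continuous Metric.isBounded_ball measurableSet_ball
    (hw.mono_set hBJ) hφ

/-- Serves twice: with `f` a smooth approximation of the weak derivatives `g`, and with `g = 0` to
bound the top-order terms by the Sobolev norm. The factor of `ε` counts the terms of `jetTop`. -/
theorem eLpNorm_jetTop_le_add {f g : (Fin n → ℕ) → Eu n → ℝ}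
    (hf : ∀ α ∈ multiIdx n (k + 1), AEStronglyMeasurable (f α) (volume.restrict J))
    (hg : ∀ α ∈ multiIdx n (k + 1), AEStronglyMeasurable (g α) (volume.restrict J)) {ε : ℝ≥0∞}
    (h : ∀ α ∈ multiIdx n (k + 1),
      eLpNorm (fun x => f α x - g α x) 2 (volume.restrict J) ≤ ε) :
    eLpNorm (jetTop k f) 2 (volume.restrict J) ≤
      eLpNorm (jetTop k g) 2 (volume.restrict J) + ((layer n k).card * n : ℕ) * ε := by
  have hmem : ∀ α ∈ layer n k, ∀ i, α + eIdx i ∈ multiIdx n (k + 1) := fun α hα i => by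
    rw [mem_multiIdx, sum_add_single, mem_layer.1 hα]
  set e : Eu n → ℝ := ∑ α ∈ layer n k, ∑ i, fun x => |f (α + eIdx i) x - g (α + eIdx i) x| with he
  have hme : ∀ α ∈ layer n k, ∀ i, AEStronglyMeasurable
      (fun x => |f (α + eIdx i) x - g (α + eIdx i) x|) (volume.restrict J) := fun α hα i =>
    ((hf _ (hmem α hα i)).sub (hg _ (hmem α hα i))).norm
  have hmi : ∀ α ∈ layer n k, AEStronglyMeasurable
      (∑ i, fun x => |f (α + eIdx i) x - g (α + eIdx i) x|) (volume.restrict J) := fun α hα =>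
    Finset.aestronglyMeasurable_sum _ fun i _ => hme α hα i
  have h1 : eLpNorm e 2 (volume.restrict J) ≤ ((layer n k).card * n : ℕ) * ε := by
    refine (eLpNorm_sum_le hmi (by norm_num)).trans ?_
    calc _ ≤ ∑ α ∈ layer n k, ∑ i : Fin n, ε := by
          refine Finset.sum_le_sum fun α hα => ?_
          refine (eLpNorm_sum_le (fun i _ => hme α hα i) (by norm_num)).trans ?_
          refine Finset.sum_le_sum fun i _ => ?_
          exact (eLpNorm_norm (fun x => f (α + eIdx i) x - g (α + eIdx i) x)).trans_le
            (h _ (hmem α hα i))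
      _ = _ := by
          simp only [Finset.sum_const, Finset.card_univ, Fintype.card_fin, nsmul_eq_mul]
          push_cast
          ring
  have hmg : AEStronglyMeasurable (jetTop k g) (volume.restrict J) := by
    have : jetTop k g = ∑ α ∈ layer n k, ∑ i, fun x => |g (α + eIdx i) x| := by
      funext x
      simp [jetTop]
    rw [this]
    exact Finset.aestronglyMeasurable_sum _ fun α hα => Finset.aestronglyMeasurable_sum _
      fun i _ => (hg _ (hmem α hα i)).norm
  have hmee : AEStronglyMeasurable e (volume.restrict J) :=
    Finset.aestronglyMeasurable_sum _ hmi
  calc eLpNorm (jetTop k f) 2 (volume.restrict J)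
      ≤ eLpNorm (jetTop k g + e) 2 (volume.restrict J) := by
        refine eLpNorm_mono_real fun x => ?_
        rw [Real.norm_of_nonneg (jetTop_nonneg _ _), Pi.add_apply, he]
        simp only [Finset.sum_apply]
        unfold jetTop
        rw [← Finset.sum_add_distrib]
        refine Finset.sum_le_sum fun α _ => ?_
        rw [← Finset.sum_add_distrib]
        refine Finset.sum_le_sum fun i _ => ?_
        have := abs_add_le (g (α + eIdx i) x) (f (α + eIdx i) x - g (α + eIdx i) x)
        rwa [add_sub_cancel] at this
    _ ≤ _ := (eLpNorm_add_le hmg hmee (by norm_num)).trans (add_le_add le_rfl h1)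

/-- The Bramble–Hilbert estimate for averaged Taylor polynomials of Sobolev functions. -/
theorem eLpNorm_sub_avgTaylor_le (hJ : IsOpen J) (hb : Bornology.IsBounded J)
    (hs : IsStarBall J c r) (hφ : Continuous φ) (hM : ∀ y, |φ y| ≤ M)
    (hφ1 : ∫ y in Metric.ball c r, φ y = 1) {u : L2 J} (hu : u ∈ sobolev (k + 1) J) :
    eLpNorm (fun x => u x - avgTaylor J c r φ k u x) 2 (volume.restrict J) ≤
      ENNReal.ofReal (M * Metric.diam J ^ (k + 1)) *
        (2 ^ n * (volume (Metric.ball c r) * volume J)) ^ (1 / 2 : ℝ) *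
          eLpNorm (jetTop k fun α => weakD J α u) 2 (volume.restrict J) := by
  obtain ⟨K, hK, hstab⟩ := exists_eLpNorm_avgT_le (k := k) hb hJ.measurableSet hs.ball_subset hM
  set C₀ : ℝ≥0∞ := ENNReal.ofReal (M * Metric.diam J ^ (k + 1)) *
        (2 ^ n * (volume (Metric.ball c r) * volume J)) ^ (1 / 2 : ℝ) with hC₀
  have hC₀t : C₀ ≠ ⊤ := by
    refine ENNReal.mul_ne_top ENNReal.ofReal_ne_top
      (ENNReal.rpow_ne_top_of_nonneg (by norm_num) ?_)
    exact ENNReal.mul_ne_top (by simp)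
      (ENNReal.mul_ne_top measure_ball_lt_top.ne hb.measure_lt_top.ne)
  set W : (Fin n → ℕ) → Eu n → ℝ := fun α => weakD J α u with hW
  have hWm : ∀ α, AEStronglyMeasurable (W α) (volume.restrict J) := fun α =>
    (Lp.memLp (weakD J α u)).1
  -- `Q` collects the coefficients of `ε` in the three errors: replacing `u` by `f 0`, replacing the
  -- top-order weak derivatives by those of the jet, and replacing the family inside `avgT`.
  set Q : ℝ≥0∞ := 1 + C₀ * ((layer n k).card * n : ℕ) + ∑ _α ∈ multiIdx n k, K with hQ
  have hQt : Q ≠ ⊤ := by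
    refine ENNReal.add_ne_top.2 ⟨ENNReal.add_ne_top.2 ⟨by simp,
      ENNReal.mul_ne_top hC₀t (ENNReal.natCast_ne_top _)⟩, ?_⟩
    exact (ENNReal.sum_lt_top.2 fun _ _ => hK.lt_top).ne
  refine ENNReal.le_of_forall_pos_le_add fun e he _ => ?_
  obtain ⟨ε, hε, hlt⟩ := ENNReal.exists_nnreal_pos_mul_lt hQt
    (b := (e : ℝ≥0∞)) (by exact_mod_cast he.ne')
  obtain ⟨f, hf, hfW⟩ := exists_isJet_eLpNorm_sub_le hJ hb hs hu (ε := ε)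
    (by exact_mod_cast hε.ne')
  have hfm : ∀ α ∈ multiIdx n (k + 1), AEStronglyMeasurable (f α) (volume.restrict J) :=
    fun α hα => (hf.cont α (mem_multiIdx.1 hα)).aestronglyMeasurable
  have hsub : ∀ α ∈ multiIdx n k, α ∈ multiIdx n (k + 1) := fun α hα => by
    rw [mem_multiIdx] at *
    omega
  have hfi : ∀ α, ∑ i, α i ≤ k → IntegrableOn (fun y => f α y * φ y) (Metric.ball c r) :=
    fun α hα => (((hf.cont α (by omega)).mul hφ).continuousOn.integrableOn_compact
      (isCompact_closedBall c r)).mono_set Metric.ball_subset_closedBall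
  have hWi : ∀ α, ∑ i, α i ≤ k → IntegrableOn (fun y => W α y * φ y) (Metric.ball c r) :=
    fun α _ => integrableOn_L2_mul hb hs.ball_subset hφ _
  have hfWm : ∀ α ∈ multiIdx n k, AEStronglyMeasurable (f α - W α) (volume.restrict J) :=
    fun α hα => (hfm α (hsub α hα)).sub (hWm α)
  have hdiff : avgT c r φ k (f - W) = avgT c r φ k f - avgT c r φ k W := by
    rw [sub_eq_add_neg f, ← neg_one_smul ℝ W, avgT_add hfi fun α hα => by
      simpa using (hWi α hα).neg, avgT_const_smul, neg_one_smul, sub_eq_add_neg]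
  have h0 : weakD J 0 u = u := weakD_zero hJ u
  have e1 : eLpNorm (fun x => u x - f 0 x) 2 (volume.restrict J) ≤ ε := by
    have := hfW 0 (by simp [mem_multiIdx])
    rw [h0] at this
    exact (eLpNorm_sub_comm (fun x => u x) (f 0) 2 _).trans_le this
  have e2 : eLpNorm (fun x => f 0 x - avgT c r φ k f x) 2 (volume.restrict J) ≤
      C₀ * (eLpNorm (jetTop k W) 2 (volume.restrict J) + ((layer n k).card * n : ℕ) * ε) :=
    (eLpNorm_jet_sub_avgT_le hJ hb hs hφ hM hφ1 hf).trans
      (mul_le_mul' le_rfl (eLpNorm_jetTop_le_add hfm (fun α _ => hWm α) hfW))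
  have e3 : eLpNorm (avgT c r φ k (f - W)) 2 (volume.restrict J) ≤
      (∑ _α ∈ multiIdx n k, K) * ε := by
    refine (hstab (f - W) hfWm).trans ?_
    rw [Finset.sum_mul]
    exact Finset.sum_le_sum fun α hα => mul_le_mul' le_rfl (hfW α (hsub α hα))
  have hm1 : AEStronglyMeasurable (fun x => u x - f 0 x) (volume.restrict J) :=
    (Lp.memLp u).1.sub (hfm 0 (by simp [mem_multiIdx]))
  have hm2 : AEStronglyMeasurable (fun x => f 0 x - avgT c r φ k f x) (volume.restrict J) :=
    (hfm 0 (by simp [mem_multiIdx])).sub (contDiff_avgT hfi).continuous.aestronglyMeasurable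
  have hm3 : AEStronglyMeasurable (avgT c r φ k (f - W)) (volume.restrict J) := by
    rw [hdiff]
    exact (contDiff_avgT hfi).continuous.aestronglyMeasurable.sub
      (contDiff_avgT hWi).continuous.aestronglyMeasurable
  have hsplit : (fun x => u x - avgTaylor J c r φ k u x) = (fun x => u x - f 0 x) +
      ((fun x => f 0 x - avgT c r φ k f x) + avgT c r φ k (f - W)) := by
    rw [hdiff, avgTaylor_eq_avgT]
    funext x
    simp only [Pi.add_apply, Pi.sub_apply]
    ring
  rw [hsplit]
  refine (eLpNorm_add_le hm1 (hm2.add hm3) (by norm_num)).trans ?_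
  refine (add_le_add e1 ((eLpNorm_add_le hm2 hm3 (by norm_num)).trans (add_le_add e2 e3))).trans ?_
  calc _ = C₀ * eLpNorm (jetTop k W) 2 (volume.restrict J) + ε * Q := by rw [hQ]; ring
    _ ≤ _ := add_le_add le_rfl hlt.le

theorem norm_weakD_le_sobolevNorm (u : L2 J) {α : Fin n → ℕ} (hα : ∑ i, α i ≤ k) :
    ‖weakD J α u‖ ≤ sobolevNorm k J u := by
  refine Real.le_sqrt_of_sq_le ?_
  exact Finset.single_le_sum (f := fun α => ‖weakD J α u‖ ^ 2) (fun _ _ => sq_nonneg _)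
    (mem_multiIdx.2 hα)

theorem eLpNorm_jetTop_weakD_le {p : ℕ} (hJ : IsOpen J) {v : L2 J} {β : Fin n → ℕ}
    (hv : v ∈ sobolev p J) (hβ : k + 1 + ∑ i, β i ≤ p) :
    eLpNorm (jetTop k fun α => weakD J α (weakD J β v)) 2 (volume.restrict J) ≤
      ENNReal.ofReal (((layer n k).card * n : ℕ) * sobolevNorm p J v) := by
  have h := eLpNorm_jetTop_le_add (J := J) (k := k) (f := fun α => weakD J α (weakD J β v))
    (g := fun _ _ => 0) (ε := ENNReal.ofReal (sobolevNorm p J v))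
    (fun α _ => (Lp.memLp (weakD J α (weakD J β v))).1)
    (fun _ _ => aestronglyMeasurable_const) fun α hα => ?_
  · have h0 : jetTop k (fun _ _ => 0 : (Fin n → ℕ) → Eu n → ℝ) = 0 := by
      funext x
      simp [jetTop]
    rwa [h0, eLpNorm_zero, zero_add, ← ENNReal.ofReal_natCast,
      ← ENNReal.ofReal_mul (Nat.cast_nonneg _)] at h
  · rw [mem_multiIdx] at hα
    simp only [sub_zero]
    rw [← Lp.enorm_def, ← ofReal_norm, weakD_weakD hJ hv (by omega)]
    refine ENNReal.ofReal_le_ofReal (norm_weakD_le_sobolevNorm v ?_)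
    simp only [Pi.add_apply, Finset.sum_add_distrib]
    omega

end BrambleHilbert

/-! ### Derivatives of polynomials -/

theorem partialD_eval {n : ℕ} (q : MvPolynomial (Fin n) ℝ) (i : Fin n) :
    partialD i (fun x => MvPolynomial.eval (fun j => x j) q) =
      fun x => MvPolynomial.eval (fun j => x j) (MvPolynomial.pderiv i q) := by
  funext x
  have hd : ∀ q : MvPolynomial (Fin n) ℝ, DifferentiableAt ℝ
      (fun x : Eu n => MvPolynomial.eval (fun j => x j) q) x := fun q =>
    (contDiff_eval q).differentiable (by simp) x
  unfold partialD
  induction q using MvPolynomial.induction_on with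
  | C a => simp
  | add p q hp hq =>
    simp only [map_add]
    rw [fderiv_fun_add (hd p) (hd q), add_apply, hp, hq]
  | mul_X p j hp =>
    have hX : HasFDerivAt (fun x : Eu n => x j) (EuclideanSpace.proj j : Eu n →L[ℝ] ℝ) x :=
      (EuclideanSpace.proj j : Eu n →L[ℝ] ℝ).hasFDerivAt
    simp only [map_mul, MvPolynomial.eval_X]
    rw [fderiv_fun_mul (hd p) hX.differentiableAt, hX.fderiv]
    simp only [add_apply, smul_apply, hp, MvPolynomial.pderiv_mul, map_add, map_mul,
      MvPolynomial.eval_X, smul_eq_mul, PiLp.proj_apply, PiLp.single_apply]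
    rcases eq_or_ne j i with rfl | h
    · simp
      ring
    · rw [MvPolynomial.pderiv_X_of_ne h]
      simp [h]
      ring

/-- The hypothesis concerns coefficients because `totalDegree 0 = 0`: a strict degree bound would be
lost in the induction once a derivative becomes the zero polynomial. -/
theorem mderiv_eval_eq_zero {n : ℕ} (α : Fin n → ℕ) (q : MvPolynomial (Fin n) ℝ)
    (hq : ∀ m : Fin n →₀ ℕ, ∑ i, α i ≤ m.degree → q.coeff m = 0) :
    mderiv α (fun x : Eu n => MvPolynomial.eval (fun j => x j) q) = 0 := by
  induction α using multiIndex_induction generalizing q with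
  | zero =>
    have : q = 0 := MvPolynomial.ext _ _ fun m => by simpa using hq m (by simp)
    rw [mderiv_zero, this]
    funext x
    simp
  | succ β i ih =>
    rw [add_comm, ← mderiv_mderiv (contDiff_eval q), mderiv_single (contDiff_eval q),
      partialD_eval]
    refine ih _ fun m hm => ?_
    rw [MvPolynomial.coeff_pderiv, hq, zero_mul]
    rw [sum_add_single, map_add, Finsupp.degree_single]
    omega

theorem mderiv_eval_of_totalDegree_lt {n p : ℕ} {α : Fin n → ℕ} {q : MvPolynomial (Fin n) ℝ}
    (hq : q ∈ MvPolynomial.restrictTotalDegree (Fin n) ℝ p) (hα : p < ∑ i, α i) :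
    mderiv α (fun x : Eu n => MvPolynomial.eval (fun j => x j) q) = 0 := by
  rw [MvPolynomial.mem_restrictTotalDegree] at hq
  exact mderiv_eval_eq_zero α q fun m hm =>
    MvPolynomial.coeff_eq_zero_of_totalDegree_lt (hq.trans_lt (hα.trans_le hm))

/-! ### The averaged Taylor polynomial as an operator -/

section Operator

variable {n p : ℕ} {J : Set (Eu n)} {c : Eu n} {r : ℝ} {φ : Eu n → ℝ}

theorem contDiff_avgTaylor (hb : Bornology.IsBounded J) (hs : IsStarBall J c r)
    (hφ : IsCutoff c r φ) (p : ℕ) (v : L2 J) : ContDiff ℝ ∞ (avgTaylor J c r φ p v) := by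
  rw [avgTaylor_eq_avgT]
  exact contDiff_avgT fun α _ => integrableOn_L2_mul hb hs.ball_subset hφ.smooth.continuous _

theorem memLp_avgTaylor (hb : Bornology.IsBounded J) (hs : IsStarBall J c r)
    (hφ : IsCutoff c r φ) (p : ℕ) (v : L2 J) :
    MemLp (avgTaylor J c r φ p v) 2 (volume.restrict J) :=
  memLp_of_continuous_of_isBounded hb (contDiff_avgTaylor hb hs hφ p v).continuous

theorem ae_ball_of_ae (hBJ : Metric.ball c r ⊆ J) {P : Eu n → Prop}
    (h : ∀ᵐ x ∂volume.restrict J, P x) : ∀ᵐ x ∂volume.restrict (Metric.ball c r), P x :=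
  ae_mono (Measure.restrict_mono hBJ le_rfl) h

theorem avgTaylor_add (hJ : IsOpen J) (hb : Bornology.IsBounded J) (hs : IsStarBall J c r)
    (hφ : IsCutoff c r φ) {u v : L2 J} (hu : u ∈ sobolev p J) (hv : v ∈ sobolev p J) :
    avgTaylor J c r φ p (u + v) = avgTaylor J c r φ p u + avgTaylor J c r φ p v := by
  have hi := integrableOn_L2_mul hb hs.ball_subset hφ.smooth.continuous
  simp only [avgTaylor_eq_avgT]
  rw [← avgT_add (fun α _ => hi _) fun α _ => hi _]
  refine avgT_congr fun α hα => ?_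
  rw [weakD_add hJ hu hv hα]
  exact ae_ball_of_ae hs.ball_subset (Lp.coeFn_add _ _)

theorem avgTaylor_smul (hJ : IsOpen J) (hs : IsStarBall J c r) (a : ℝ) {u : L2 J}
    (hu : u ∈ sobolev p J) :
    avgTaylor J c r φ p (a • u) = a • avgTaylor J c r φ p u := by
  simp only [avgTaylor_eq_avgT]
  rw [← avgT_const_smul]
  refine avgT_congr fun α hα => ?_
  rw [weakD_smul hJ a hu hα]
  exact ae_ball_of_ae hs.ball_subset (Lp.coeFn_smul _ _)

theorem sobolev_anti {k l : ℕ} (h : k ≤ l) : sobolev l J ≤ sobolev k J := fun _ hu α hα =>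
  hu α (mem_multiIdx.2 ((mem_multiIdx.1 hα).trans h))

/-- The averaged Taylor polynomial as a linear operator on `H^{p+1}(J)`. -/
noncomputable def avgTaylorOp (p : ℕ) (hJ : IsOpen J) (hb : Bornology.IsBounded J) (hs : IsStarBall J c r)
    (hφ : IsCutoff c r φ) : sobolev (p + 1) J →ₗ[ℝ] sobolev (p + 1) J where
  toFun v := ⟨(memLp_avgTaylor hb hs hφ p v).toLp,
    mem_sobolev_of_contDiff hb (contDiff_avgTaylor hb hs hφ p v) _ (MemLp.coeFn_toLp _)⟩
  map_add' u v :=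
    have h := memLp_avgTaylor hb hs hφ p
    Subtype.ext <| (MemLp.toLp_congr (h (u + v : L2 J)) ((h u).add (h v)) (.of_eq
      (avgTaylor_add hJ hb hs hφ (sobolev_anti p.le_succ u.2) (sobolev_anti p.le_succ v.2)))).trans
      (MemLp.toLp_add (h u) (h v))
  map_smul' a u :=
    have h := memLp_avgTaylor hb hs hφ p
    Subtype.ext <| (MemLp.toLp_congr (h (a • u : L2 J)) ((h u).const_smul a) (.of_eq
      (avgTaylor_smul hJ hs a (sobolev_anti p.le_succ u.2)))).trans (MemLp.toLp_const_smul a (h u))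

theorem mderiv_avgTaylor (hJ : IsOpen J) (hb : Bornology.IsBounded J) (hs : IsStarBall J c r)
    (hφ : IsCutoff c r φ) {v : L2 J} (hv : v ∈ sobolev p J) {α : Fin n → ℕ}
    (hα : ∑ i, α i ≤ p) :
    mderiv α (avgTaylor J c r φ p v) = avgTaylor J c r φ (p - ∑ i, α i) (weakD J α v) := by
  rw [avgTaylor_eq_avgT, avgTaylor_eq_avgT, mderiv_avgT
    (fun α _ => integrableOn_L2_mul hb hs.ball_subset hφ.smooth.continuous _), if_pos hα]
  refine avgT_congr fun β hβ => ?_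
  rw [weakD_weakD hJ hv (by omega)]
  exact .of_forall fun _ => rfl

theorem isAvgTaylorOp_avgTaylorOp (hJ : IsOpen J) (hb : Bornology.IsBounded J)
    (hs : IsStarBall J c r) (hφ : IsCutoff c r φ) :
    IsAvgTaylorOp J c r φ p (avgTaylorOp p hJ hb hs hφ) := fun v =>
  (memLp_avgTaylor hb hs hφ p v).coeFn_toLp

/-- The error estimate for an averaged Taylor polynomial, with explicit constant. -/
theorem norm_weakD_sub_avgTaylorOp_le (hJ : IsOpen J) (hb : Bornology.IsBounded J)
    (hs : IsStarBall J c r) (hφ : IsCutoff c r φ) {M : ℝ} (hM : ∀ y, |φ y| ≤ M)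
    {T : sobolev (p + 1) J →ₗ[ℝ] sobolev (p + 1) J} (hT : IsAvgTaylorOp J c r φ p T) :
    HasApproxBounds J p T (M * √(2 ^ n * (volume.real (Metric.ball c r) * volume.real J)) *
      ((multiIdx n p).card * n : ℕ)) := by
  intro v β hβ
  have hM0 : 0 ≤ M := (abs_nonneg _).trans (hM c)
  -- By commutation, `D^β (v - T v)` is the error of the averaged Taylor polynomial of order `p -
  -- |β|` of `D^β v`.
  have hTv : weakD J β (T v) =ᵐ[volume.restrict J]
      avgTaylor J c r φ (p - ∑ i, β i) (weakD J β v) := by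
    rw [weakD_of_contDiff hJ hb (contDiff_avgTaylor hb hs hφ p v) β (hT v)]
    refine (MemLp.coeFn_toLp _).trans (.of_eq ?_)
    exact mderiv_avgTaylor hJ hb hs hφ (sobolev_anti p.le_succ v.2) hβ
  set k := p - ∑ i, β i with hk
  have hkp : p + 1 - ∑ i, β i = k + 1 := by omega
  have hw : weakD J β v ∈ sobolev (k + 1) J := weakD_mem_sobolev v.2 (by omega)
  have hmain := eLpNorm_sub_avgTaylor_le hJ hb hs hφ.smooth.continuous hM hφ.integral hw
  have hN : 0 ≤ sobolevNorm (p + 1) J (v : L2 J) := Real.sqrt_nonneg _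
  -- Enlarging the layer to all indices of order at most `p` makes the constant independent of `β`.
  have hcard : (layer n k).card ≤ (multiIdx n p).card :=
    Finset.card_le_card fun α hα => by
      rw [mem_layer] at hα
      rw [mem_multiIdx]
      omega
  have htop := (eLpNorm_jetTop_weakD_le hJ v.2 (k := k) (β := β) (by omega)).trans
    (ENNReal.ofReal_le_ofReal (mul_le_mul_of_nonneg_right
      (Nat.cast_le.2 (Nat.mul_le_mul_right n hcard)) hN))
  have hvol : (2 ^ n * (volume (Metric.ball c r) * volume J)) ^ (1 / 2 : ℝ) =
      ENNReal.ofReal (√(2 ^ n * (volume.real (Metric.ball c r) * volume.real J))) := by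
    rw [Real.sqrt_eq_rpow, ← ENNReal.ofReal_rpow_of_nonneg (by positivity) (by norm_num),
      ENNReal.ofReal_mul (by positivity), ENNReal.ofReal_mul measureReal_nonneg,
      ofReal_measureReal measure_ball_lt_top.ne, ofReal_measureReal hb.measure_lt_top.ne,
      ENNReal.ofReal_pow (by norm_num), ENNReal.ofReal_ofNat]
  have hnorm : ‖weakD J β ((v - T v : sobolev (p + 1) J) : L2 J)‖ₑ =
      eLpNorm (fun x => weakD J β (v : L2 J) x -
        avgTaylor J c r φ k (weakD J β (v : L2 J)) x) 2 (volume.restrict J) := by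
    rw [Submodule.coe_sub, weakD_sub hJ v.2 (T v).2 (by omega), Lp.enorm_def]
    refine eLpNorm_congr_ae ?_
    filter_upwards [Lp.coeFn_sub (weakD J β (v : L2 J)) (weakD J β (T v : L2 J)), hTv]
      with x h1 h2
    rw [h1, Pi.sub_apply, h2]
  have hle : ‖weakD J β ((v - T v : sobolev (p + 1) J) : L2 J)‖ₑ ≤ ENNReal.ofReal
      (M * √(2 ^ n * (volume.real (Metric.ball c r) * volume.real J)) *
        ((multiIdx n p).card * n : ℕ) * Metric.diam J ^ (k + 1) *
          sobolevNorm (p + 1) J (v : L2 J)) := by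
    rw [hnorm]
    refine (hmain.trans (mul_le_mul' le_rfl htop)).trans (le_of_eq ?_)
    have hD : 0 ≤ Metric.diam J := Metric.diam_nonneg
    rw [hvol, ← ENNReal.ofReal_mul (by positivity), ← ENNReal.ofReal_mul (by positivity)]
    congr 1
    ring
  rw [hkp]
  rw [← ofReal_norm] at hle
  exact (ENNReal.ofReal_le_ofReal_iff (by have := Metric.diam_nonneg (s := J); positivity)).1 hle

theorem exists_abs_le_of_isCutoff (hφ : IsCutoff c r φ) : ∃ M, ∀ y, |φ y| ≤ M := by
  have hc : HasCompactSupport φ := by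
    rw [HasCompactSupport, hφ.supp]
    exact isCompact_closedBall c r
  exact hc.exists_bound_of_continuous hφ.smooth.continuous

theorem isPolyProjector_avgTaylorOp (hJ : IsOpen J) (hb : Bornology.IsBounded J)
    (hs : IsStarBall J c r) (hφ : IsCutoff c r φ) :
    IsPolyProjector J p (avgTaylorOp p hJ hb hs hφ) := by
  refine ⟨⟨fun v => ?_, fun v hv => ?_⟩, fun q hq => ?_⟩
  · obtain ⟨q, hq, h⟩ := exists_polynomial_avgT (p := p) (g := fun α => weakD J α (v : L2 J))
      fun α _ => integrableOn_L2_mul hb hs.ball_subset hφ.smooth.continuous _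
    refine ⟨q, hq, ?_⟩
    refine (isAvgTaylorOp_avgTaylorOp hJ hb hs hφ v).trans (.of_eq ?_)
    rw [avgTaylor_eq_avgT]
    exact funext h
  · obtain ⟨q, hq, hv⟩ := hv
    obtain ⟨M, hM⟩ := exists_abs_le_of_isCutoff hφ
    -- Derivatives of order `p + 1` of a polynomial of degree at most `p` vanish, hence so does the
    -- right side of the error estimate, and `T` fixes the polynomial.
    have hzero : ∀ α ∈ layer n p, ∀ i, weakD J (α + eIdx i) (v : L2 J) = 0 := by
      intro α hα i
      refine IsWeakDeriv.weakD_eq hJ (isWeakDeriv_of_contDiff (contDiff_eval q) hv ?_)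
      rw [mderiv_eval_of_totalDegree_lt hq (by rw [sum_add_single, mem_layer.1 hα]; omega)]
      exact Lp.coeFn_zero _ _ _
    have hall : ∀ᵐ x ∂volume.restrict J, jetTop p (fun α => weakD J α (v : L2 J)) x = 0 := by
      filter_upwards [Lp.coeFn_zero ℝ 2 (volume.restrict J)] with x hx
      refine Finset.sum_eq_zero fun α hα => Finset.sum_eq_zero fun i _ => ?_
      simp only [hzero α hα i, hx, Pi.zero_apply, abs_zero]
    have h := eLpNorm_sub_avgTaylor_le hJ hb hs hφ.smooth.continuous hM hφ.integral v.2
    rw [eLpNorm_congr_ae (g := 0) hall, eLpNorm_zero, mul_zero, nonpos_iff_eq_zero] at h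
    replace h := (eLpNorm_eq_zero_iff ((Lp.memLp (v : L2 J)).1.sub
      (memLp_avgTaylor hb hs hφ p v).1) (by norm_num)).1 h
    ext1
    refine Lp.ext ((isAvgTaylorOp_avgTaylorOp hJ hb hs hφ v).trans ?_)
    filter_upwards [h] with x hx
    exact (sub_eq_zero.1 hx).symm
  · have hm := memLp_of_continuous_of_isBounded hb (contDiff_eval q).continuous
    exact ⟨⟨hm.toLp, mem_sobolev_of_contDiff hb (contDiff_eval q) _ hm.coeFn_toLp⟩,
      hm.coeFn_toLp⟩

end Operator

/-! ### The wave equation -/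

section Wave

/-- Integration against a fixed smooth compactly supported function, as a linear functional on
`L²(J)`. -/
noncomputable def testPairing {n : ℕ} (J : Set (Eu n)) {ψ : Eu n → ℝ}
    (hψ : ContDiff ℝ ∞ ψ ∧ HasCompactSupport ψ) : L2 J →ₗ[ℝ] ℝ where
  toFun u := ∫ x in J, u x * ψ x
  map_add' u v := by
    rw [← integral_add (integrable_mul_good u hψ) (integrable_mul_good v hψ)]
    refine integral_congr_ae ?_
    filter_upwards [Lp.coeFn_add u v] with x hx
    rw [hx, Pi.add_apply, add_mul]
  map_smul' a u := by
    rw [RingHom.id_apply, smul_eq_mul, ← integral_const_mul]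
    refine integral_congr_ae ?_
    filter_upwards [Lp.coeFn_smul a u] with x hx
    rw [hx, Pi.smul_apply, smul_eq_mul, mul_assoc]

theorem mderiv_two {n : ℕ} {ψ : Eu n → ℝ} (hψ : ContDiff ℝ ∞ ψ) (i : Fin n) :
    mderiv (eIdx i + eIdx i) ψ = partialD i (partialD i ψ) := by
  rw [← partialD_mderiv hψ, mderiv_single hψ]

theorem sum_two {n : ℕ} (i : Fin n) : ∑ j, (eIdx i + eIdx i) j = 2 := by
  rw [sum_add_single, sum_single_one]

variable {d p : ℕ} {J : Set (Eu (d + 1))}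

theorem setIntegral_mul_wave (u : L2 J) (a : ℝ) {ψ : Eu (d + 1) → ℝ} (hψ : IsTest J ψ) :
    ∫ x in J, u x * (partialD (Fin.last d) (partialD (Fin.last d) ψ) x
      - a * ∑ i : Fin d, partialD i.castSucc (partialD i.castSucc ψ) x) =
    (∫ x in J, u x * partialD (Fin.last d) (partialD (Fin.last d) ψ) x) -
      a * ∑ i : Fin d, ∫ x in J, u x * partialD i.castSucc (partialD i.castSucc ψ) x := by
  have hint : ∀ i, Integrable (fun x => u x * partialD i (partialD i ψ) x)
      (volume.restrict J) := fun i => integrable_mul_good u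
    ⟨((hψ.partialD i).partialD i).smooth, ((hψ.partialD i).partialD i).compact⟩
  rw [← integral_finsetSum _ fun i _ => hint _, ← integral_const_mul, ← integral_sub (hint _)
    ((integrable_finsetSum _ fun i _ => hint _).const_mul a)]
  congr 1
  funext x
  rw [mul_sub, ← Finset.mul_sum]
  ring

/-- The distributional equation is tested with `D^β ψ`; as `|β| + 2 ≤ p`, all derivatives can be
moved onto `v`, which gives the differentiated equation as an identity in `L²`. -/
theorem weakD_wave_eq_zero (hJ : IsOpen J) {a : ℝ} {v : L2 J} (hv : v ∈ sobolev p J)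
    (hw : IsWaveSol J a v) {β : Fin (d + 1) → ℕ} (hβ : ∑ i, β i + 2 ≤ p) :
    weakD J (β + (eIdx (Fin.last d) + eIdx (Fin.last d))) v -
      a • ∑ i : Fin d, weakD J (β + (eIdx i.castSucc + eIdx i.castSucc)) v = 0 := by
  refine L2.ext_of_integral_test hJ fun ψ hψ => ?_
  have hχ := hψ.mderiv β
  have hd : ∀ i, testPairing J ⟨hψ.smooth, hψ.compact⟩
      (weakD J (β + (eIdx i + eIdx i)) v) = (-1) ^ (∑ i, β i) *
        ∫ x in J, v x * partialD i (partialD i (mderiv β ψ)) x := by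
    intro i
    have hs : ∑ j, (β + (eIdx i + eIdx i)) j = ∑ j, β j + 2 := by
      rw [← add_assoc, sum_add_single, sum_add_single]
    have h := isWeakDeriv_weakD hv (hs.trans_le hβ) ψ hψ
    rw [← mderiv_mderiv hψ.smooth, mderiv_two hχ.smooth, hs, pow_add] at h
    rw [h]
    have h1 : ((-1 : ℝ) ^ (∑ i, β i)) * (-1) ^ (∑ i, β i) = 1 := by
      rw [← pow_add, ← two_mul, pow_mul]
      simp
    change ∫ x in J, _ = _
    rw [neg_one_sq, mul_one, ← mul_assoc, h1, one_mul]
  have h := hw _ hχ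
  rw [setIntegral_mul_wave v a hχ] at h
  change testPairing J ⟨hψ.smooth, hψ.compact⟩ _ = testPairing J ⟨hψ.smooth, hψ.compact⟩ 0
  rw [map_zero, map_sub, map_smul, map_sum, smul_eq_mul]
  simp only [hd]
  rw [← Finset.mul_sum, mul_left_comm, ← mul_sub, h, mul_zero]

/-- The polynomial is shown to solve the equation classically: each term of `avgT` of order `p - 2`
contains a differentiated wave equation for `v`. Integration by parts returns to the distributional
form. -/
theorem preservesWaveSol_of_isAvgTaylorOp {c : Eu (d + 1)} {r : ℝ} {φ : Eu (d + 1) → ℝ}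
    (hJ : IsOpen J) (hb : Bornology.IsBounded J) (hs : IsStarBall J c r) (hφ : IsCutoff c r φ)
    {T : sobolev (p + 1) J →ₗ[ℝ] sobolev (p + 1) J} (hT : IsAvgTaylorOp J c r φ p T) :
    PreservesWaveSol J p T := by
  intro a _ v hv ψ hψ
  set F := avgTaylor J c r φ p (v : L2 J) with hF
  have hFs : ContDiff ℝ ∞ F := contDiff_avgTaylor hb hs hφ p v
  have hi := integrableOn_L2_mul hb hs.ball_subset hφ.smooth.continuous
  have hFd : ∀ i, mderiv (eIdx i + eIdx i) F = if 2 ≤ p then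
      avgT c r φ (p - 2) (fun β => weakD J (β + (eIdx i + eIdx i)) (v : L2 J)) else 0 := by
    intro i
    rw [hF, avgTaylor_eq_avgT, mderiv_avgT (fun α _ => hi _), sum_two]
  have hzero : ∀ x, mderiv (eIdx (Fin.last d) + eIdx (Fin.last d)) F x -
      a * ∑ i : Fin d, mderiv (eIdx i.castSucc + eIdx i.castSucc) F x = 0 := by
    intro x
    simp only [hFd]
    split_ifs with hp
    · unfold avgT
      rw [Finset.sum_comm, Finset.mul_sum, ← Finset.sum_sub_distrib]
      refine Finset.sum_eq_zero fun β hβ => ?_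
      rw [mem_multiIdx] at hβ
      have hint : ∀ i : Fin (d + 1), IntegrableOn (fun y =>
          weakD J (β + (eIdx i + eIdx i)) (v : L2 J) y * φ y * mono β (x - y))
          (Metric.ball c r) := fun i => integrableOn_mul_mono (hi _) β x
      rw [← Finset.mul_sum, mul_left_comm, ← mul_sub, ← integral_finsetSum _ fun i _ => hint _,
        ← integral_const_mul, ← integral_sub (hint _)
        ((integrable_finsetSum _ fun i _ => hint _).const_mul a)]
      refine mul_eq_zero_of_right _ ?_
      have hz := weakD_wave_eq_zero hJ v.2 hv (β := β) (by omega)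
      rw [← integral_zero (Eu (d + 1)) ℝ (μ := volume.restrict (Metric.ball c r))]
      refine integral_congr_ae (ae_ball_of_ae hs.ball_subset ?_)
      have hsum : ∀ᵐ y ∂volume.restrict J, (∑ i : Fin d,
          weakD J (β + (eIdx i.castSucc + eIdx i.castSucc)) (v : L2 J)) y =
          ∑ i : Fin d, weakD J (β + (eIdx i.castSucc + eIdx i.castSucc)) (v : L2 J) y := by
        filter_upwards [Lp.coeFn_finsetSum Finset.univ fun i : Fin d =>
          weakD J (β + (eIdx i.castSucc + eIdx i.castSucc)) (v : L2 J)] with y hy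
        rw [hy, Finset.sum_apply]
      filter_upwards [hsum, Lp.coeFn_sub
        (weakD J (β + (eIdx (Fin.last d) + eIdx (Fin.last d))) (v : L2 J))
        (a • ∑ i : Fin d, weakD J (β + (eIdx i.castSucc + eIdx i.castSucc)) (v : L2 J)),
        Lp.coeFn_smul a
          (∑ i : Fin d, weakD J (β + (eIdx i.castSucc + eIdx i.castSucc)) (v : L2 J)),
        Lp.coeFn_zero ℝ 2 (volume.restrict J)] with y h1 h2 h3 h4
      rw [hz, h4, Pi.sub_apply, h3, Pi.smul_apply, h1, Pi.zero_apply, smul_eq_mul] at h2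
      simp only [mul_assoc]
      rw [← Finset.sum_mul, ← mul_assoc a, ← sub_mul, ← h2, zero_mul]
    · simp
  have hibp : ∀ i, ∫ x in J, (T v : L2 J) x * partialD i (partialD i ψ) x =
      ∫ x in J, mderiv (eIdx i + eIdx i) F x * ψ x := by
    intro i
    rw [← mderiv_two hψ.smooth]
    have h1 : ∫ x in J, (T v : L2 J) x * mderiv (eIdx i + eIdx i) ψ x =
        ∫ x in J, F x * mderiv (eIdx i + eIdx i) ψ x := by
      refine integral_congr_ae ?_
      filter_upwards [hT v] with x hx
      rw [hx]
    rw [h1, setIntegral_mul_mderiv hFs hψ, sum_two]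
    simp
  rw [setIntegral_mul_wave _ a hψ]
  simp only [hibp]
  have hint : ∀ i : Fin (d + 1), Integrable (fun x => mderiv (eIdx i + eIdx i) F x * ψ x)
      (volume.restrict J) := fun i =>
    (((contDiff_mderiv hFs _).continuous.mul hψ.smooth.continuous).integrable_of_hasCompactSupport
      hψ.compact.mul_left).integrableOn
  rw [← integral_finsetSum _ fun i _ => hint _, ← integral_const_mul, ← integral_sub (hint _)
    ((integrable_finsetSum _ fun i _ => hint _).const_mul a)]
  rw [← integral_zero (Eu (d + 1)) ℝ (μ := volume.restrict J)]
  congr 1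
  funext x
  rw [← Finset.sum_mul, ← mul_assoc, ← sub_mul, hzero, zero_mul]

end Wave

/-! ### Constants controlled by the chunkiness -/

theorem exists_isStarBall_diam_le {d : ℕ} {J : Set (Eu (d + 1))} (hb : Bornology.IsBounded J)
    (hex : ∃ c r, IsStarBall J c r) {γ : ℝ} (hγ : chunkiness J ≤ γ) :
    ∃ c r, IsStarBall J c r ∧ Metric.diam J ≤ 2 * γ * r := by
  set S := {ρ : ℝ | ∃ c : Eu (d + 1), IsStarBall J c ρ} with hS
  obtain ⟨c₀, r₀, h₀⟩ := hex
  -- Needed because the real `sSup` of an unbounded set is `0`. If `ρ > diam J`, the point at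
  -- distance `(diam J + ρ) / 2` from `c` along a coordinate axis lies in the ball but farther than
  -- `diam J` from `c`.
  have hbdd : BddAbove S := by
    refine ⟨Metric.diam J, ?_⟩
    rintro ρ ⟨c, hc⟩
    by_contra! h
    have hx : c + (Metric.diam J + ρ) • (2⁻¹ : ℝ) • EuclideanSpace.single (0 : Fin (d + 1)) (1 : ℝ)
        ∈ Metric.ball c ρ := by
      rw [Metric.mem_ball, dist_eq_norm, add_sub_cancel_left, norm_smul, norm_smul,
        PiLp.norm_single, Real.norm_of_nonneg (by linarith [Metric.diam_nonneg (s := J), hc.pos])]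
      norm_num
      linarith
    have h1 := Metric.dist_le_diam_of_mem hb (hc.ball_subset hx)
      (hc.ball_subset (Metric.mem_ball_self hc.pos))
    rw [dist_eq_norm, add_sub_cancel_left, norm_smul, norm_smul, PiLp.norm_single,
      Real.norm_of_nonneg (by linarith [Metric.diam_nonneg (s := J), hc.pos])] at h1
    norm_num at h1
    linarith
  have hpos : 0 < sSup S := h₀.pos.trans_le (le_csSup hbdd ⟨c₀, h₀⟩)
  -- Attainment of the supremum is not needed: a radius above half of it costs only the factor `2`.
  obtain ⟨r, ⟨c, hc⟩, hr⟩ := exists_lt_of_lt_csSup (s := S) ⟨r₀, c₀, h₀⟩ (half_lt_self hpos)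
  refine ⟨c, r, hc, ?_⟩
  have h1 : Metric.diam J ≤ γ * sSup S := (div_le_iff₀ hpos).1 hγ
  have hγ0 : 0 ≤ γ := (div_nonneg Metric.diam_nonneg hpos.le).trans hγ
  nlinarith

/-- The standard weight for the ball `B(c, r)`. -/
noncomputable def stdBump {n : ℕ} (c : Eu n) {r : ℝ} (hr : 0 < r) : ContDiffBump c :=
  ⟨r / 2, r, by linarith, by linarith⟩

theorem isCutoff_stdBump {n : ℕ} (c : Eu n) {r : ℝ} (hr : 0 < r) :
    IsCutoff c r ((stdBump c hr).normed volume) where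
  smooth := (stdBump c hr).contDiff_normed (n := ⊤)
  supp := (stdBump c hr).tsupport_normed_eq
  integral := by
    rw [setIntegral_eq_integral_of_forall_compl_eq_zero, (stdBump c hr).integral_normed]
    intro x hx
    by_contra h
    exact hx (((stdBump c hr).support_normed_eq (μ := volume)).subset h)

/-- Before normalization the bump is at most one, and it equals one on the ball of radius `r / 2`,
whose volume therefore bounds its integral from below. -/
theorem abs_stdBump_le {n : ℕ} (c : Eu n) {r : ℝ} (hr : 0 < r) (y : Eu n) :
    |(stdBump c hr).normed volume y| ≤ 2 ^ n / (r ^ n * volume.real (Metric.ball (0 : Eu n) 1)) := by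
  rw [abs_of_nonneg ((stdBump c hr).nonneg_normed y)]
  refine ((stdBump c hr).normed_le_div_measure_closedBall_rIn volume y).trans (le_of_eq ?_)
  have h1 : (stdBump c hr).rIn = r / 2 := rfl
  rw [h1, Measure.addHaar_real_closedBall _ _ (by positivity), finrank_euclideanSpace_fin, div_pow]
  have hV : 0 < volume.real (Metric.ball (0 : Eu n) 1) :=
    ENNReal.toReal_pos (Metric.measure_ball_pos _ _ one_pos).ne' measure_ball_lt_top.ne
  field_simp

/-- `J` lies in the closed ball of radius `2 * γ * r` about `c`, so both volumes are at most
multiples of `r ^ n`; the square root of their product cancels the `r ^ n` in the bound of the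
weight. -/
theorem stdBump_const_le {n : ℕ} {J : Set (Eu n)} {c : Eu n} {r γ : ℝ}
    (hb : Bornology.IsBounded J) (hs : IsStarBall J c r) (hγ : Metric.diam J ≤ 2 * γ * r) :
    2 ^ n / (r ^ n * volume.real (Metric.ball (0 : Eu n) 1)) *
      √(2 ^ n * (volume.real (Metric.ball c r) * volume.real J)) ≤ 2 ^ n * √((4 * γ) ^ n) := by
  have hr := hs.pos
  set V := volume.real (Metric.ball (0 : Eu n) 1) with hVdef
  have hV : 0 < V :=
    ENNReal.toReal_pos (Metric.measure_ball_pos _ _ one_pos).ne' measure_ball_lt_top.ne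
  have hD : 0 ≤ Metric.diam J := Metric.diam_nonneg
  have hγ0 : 0 ≤ γ := by
    by_contra! h
    nlinarith [mul_neg_of_neg_of_pos h hr]
  have h1 : volume.real (Metric.ball c r) ≤ r ^ n * V := by
    refine (measureReal_mono Metric.ball_subset_closedBall
      (isCompact_closedBall c r).measure_lt_top.ne).trans (le_of_eq ?_)
    rw [Measure.addHaar_real_closedBall _ _ hr.le, finrank_euclideanSpace_fin]
  have h2 : volume.real J ≤ (2 * γ * r) ^ n * V := by
    refine (measureReal_mono (s₂ := Metric.closedBall c (2 * γ * r)) (fun x hx => ?_)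
      (isCompact_closedBall c _).measure_lt_top.ne).trans (le_of_eq ?_)
    · exact (Metric.dist_le_diam_of_mem hb hx
        (hs.ball_subset (Metric.mem_ball_self hr))).trans hγ
    · rw [Measure.addHaar_real_closedBall _ _ (by positivity), finrank_euclideanSpace_fin]
  have h3 : √(2 ^ n * (volume.real (Metric.ball c r) * volume.real J)) ≤
      r ^ n * V * √((4 * γ) ^ n) := by
    refine Real.sqrt_le_iff.2 ⟨by positivity, ?_⟩
    rw [mul_pow (r ^ n * V), Real.sq_sqrt (by positivity)]
    calc 2 ^ n * (volume.real (Metric.ball c r) * volume.real J)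
        ≤ 2 ^ n * ((r ^ n * V) * ((2 * γ * r) ^ n * V)) := by gcongr
      _ = (r ^ n * V) ^ 2 * (4 * γ) ^ n := by
        rw [show (4 : ℝ) = 2 * 2 by norm_num]
        simp only [mul_pow]
        ring
  calc _ ≤ 2 ^ n / (r ^ n * V) * (r ^ n * V * √((4 * γ) ^ n)) := by gcongr
    _ = _ := by field_simp

theorem HasApproxBounds.mono {n p : ℕ} {J : Set (Eu n)}
    {T : sobolev (p + 1) J →ₗ[ℝ] sobolev (p + 1) J} {C C' : ℝ} (h : HasApproxBounds J p T C)
    (hC : C ≤ C') : HasApproxBounds J p T C' := fun v β hβ => by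
  refine (h v β hβ).trans ?_
  have := Metric.diam_nonneg (s := J)
  have : 0 ≤ sobolevNorm (p + 1) J (v : L2 J) := Real.sqrt_nonneg _
  gcongr

end Trefftz

/-! ### The two parts of the theorem -/

theorem mainTheorem10 (d p : ℕ) :
    -- existence of the projector, with a constant depending only on `d`, `p` and the chunkiness
    (∀ γ : ℝ, ∃ C : ℝ, ∀ J : Set (Trefftz.Eu (d + 1)), IsOpen J → Bornology.IsBounded J →
      (∃ (c : Trefftz.Eu (d + 1)) (r : ℝ), Trefftz.IsStarBall J c r) →
      Trefftz.chunkiness J ≤ γ →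
      ∃ (c : Trefftz.Eu (d + 1)) (r : ℝ) (φ : Trefftz.Eu (d + 1) → ℝ)
        (T : Trefftz.sobolev (p + 1) J →ₗ[ℝ] Trefftz.sobolev (p + 1) J),
        Trefftz.IsStarBall J c r ∧ Trefftz.IsCutoff c r φ ∧
        Trefftz.IsAvgTaylorOp J c r φ p T ∧
        Trefftz.IsPolyProjector J p T ∧
        Trefftz.HasApproxBounds J p T C ∧
        Trefftz.PreservesWaveSol J p T) ∧
    -- the averaged Taylor polynomials over an arbitrary ball, with an arbitrary weight
    (∀ J : Set (Trefftz.Eu (d + 1)), IsOpen J → Bornology.IsBounded J →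
      ∀ (c : Trefftz.Eu (d + 1)) (r : ℝ), Trefftz.IsStarBall J c r →
      ∀ φ : Trefftz.Eu (d + 1) → ℝ, Trefftz.IsCutoff c r φ →
      (∃ T : Trefftz.sobolev (p + 1) J →ₗ[ℝ] Trefftz.sobolev (p + 1) J,
        Trefftz.IsAvgTaylorOp J c r φ p T ∧
        Trefftz.IsPolyProjector J p T ∧
        (∃ C : ℝ, Trefftz.HasApproxBounds J p T C) ∧
        Trefftz.PreservesWaveSol J p T) ∧
      (∀ v ∈ Trefftz.sobolev (p + 1) J, ∀ α : Fin (d + 1) → ℕ, ∑ i, α i ≤ p →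
        Trefftz.weakD J α v ∈ Trefftz.sobolev (p + 1 - ∑ i, α i) J ∧
        Trefftz.mderiv α (Trefftz.avgTaylor J c r φ p v) =
          Trefftz.avgTaylor J c r φ (p - ∑ i, α i) (Trefftz.weakD J α v))) := by
  constructor
  · intro γ
    -- The first two factors come from `stdBump_const_le`; the last bounds the number of top-order
    -- terms in the remainder.
    refine ⟨2 ^ (d + 1) * √((4 * γ) ^ (d + 1)) *
      ((Trefftz.multiIdx (d + 1) p).card * (d + 1) : ℕ), fun J hJ hb hex hγ => ?_⟩
    obtain ⟨c, r, hs, hd⟩ := Trefftz.exists_isStarBall_diam_le hb hex hγ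
    have hφ := Trefftz.isCutoff_stdBump c hs.pos
    have hT := Trefftz.isAvgTaylorOp_avgTaylorOp (p := p) hJ hb hs hφ
    refine ⟨c, r, _, Trefftz.avgTaylorOp p hJ hb hs hφ, hs, hφ, hT,
      Trefftz.isPolyProjector_avgTaylorOp hJ hb hs hφ, ?_,
      Trefftz.preservesWaveSol_of_isAvgTaylorOp hJ hb hs hφ hT⟩
    refine (Trefftz.norm_weakD_sub_avgTaylorOp_le hJ hb hs hφ
      (Trefftz.abs_stdBump_le c hs.pos) hT).mono ?_
    exact mul_le_mul_of_nonneg_right (Trefftz.stdBump_const_le hb hs hd) (Nat.cast_nonneg _)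
  · intro J hJ hb c r hs φ hφ
    obtain ⟨M, hM⟩ := Trefftz.exists_abs_le_of_isCutoff hφ
    have hT := Trefftz.isAvgTaylorOp_avgTaylorOp (p := p) hJ hb hs hφ
    refine ⟨⟨Trefftz.avgTaylorOp p hJ hb hs hφ, hT,
      Trefftz.isPolyProjector_avgTaylorOp hJ hb hs hφ,
      ⟨_, Trefftz.norm_weakD_sub_avgTaylorOp_le hJ hb hs hφ hM hT⟩,
      Trefftz.preservesWaveSol_of_isAvgTaylorOp hJ hb hs hφ hT⟩, fun v hv α hα => ⟨?_, ?_⟩⟩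
    · exact Trefftz.weakD_mem_sobolev hv (by omega)
    · exact Trefftz.mderiv_avgTaylor hJ hb hs hφ (Trefftz.sobolev_anti p.le_succ hv) hα
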